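/- Let $R$ be a commutative ring and let $X$ be a locally compact, second-countable Hausdorff space with a filtration by closed subsets $\emptyset=X_{-1}\subseteq X_0\subseteq\dots\subseteq X_n=X$. The strata of dimension $i$ are the connected components $S$ of $X_i\setminus X_{i-1}$; put $\operatorname{codim}S=n-i$. Let $\overline p$ be a perversity, i.e. a function from the set of strata to $\mathbb Z$ that vanishes on the strata of dimension $n$. A subspace $A\subseteq X$ carries the induced filtration and the induced perversity: $\overline p(S)=\overline p(S')$ if the stratum $S$ of $A$ lies in the stratum $S'$ of $X$. A regular simplex is a continuous map $\sigma\colon\Delta\to X$ on a simplex with ordered vertices, decomposed as a join $\Delta=\Delta_0*\dots*\Delta_n$ of consecutive (possibly empty) blocks, such that $\sigma^{-1}(X_i)=\Delta_0*\dots*\Delta_i$ for all $i$ and $\Delta_n\neq\emptyset$. Its differential $\mathfrak d\sigma$ is the part of the usual boundary $\partial\sigma$ formed by the regular faces. The simplex $\sigma$ is $\overline p$-allowable if $\dim\sigma^{-1}(X_{\dim S})\le\dim\Delta-\operatorname{codim}S+\overline p(S)$ for every stratum $S$ that meets $\sigma(\Delta)$. A chain $\xi$ of regular simplices with coefficients in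 $R$ is a $\overline p$-intersection chain if all simplices occurring in $\xi$ and in $\mathfrak d\xi$ are $\overline p$-allowable. Let $\mathfrak C^{\overline p}_*(X;R)$ be the complex of finite $\overline p$-intersection chains, and let $\mathfrak C^{\infty,\overline p}_*(X;R)$ be the complex of locally finite ones (possibly infinite chains such that every point has a neighbourhood meeting only finitely many simplices with non-zero coefficient). For $A\subseteq X$ open, $\mathfrak C^{\overline p}_*(X,A;R)=\mathfrak C^{\overline p}_*(X;R)/\mathfrak C^{\overline p}_*(A;R)$. Let $U\subseteq X$ be an open subset and put $$\mathfrak C^{\infty,X,\overline p}_*(U;R)=\varprojlim_{K\subseteq U}\mathfrak C^{\overline p}_*(X,X\setminus K;R),$$ where $K$ runs over the compact subsets of $U$. Then the natural restriction $$I^{\overline p}_U\colon\mathfrak C^{\infty,\overline p}_*(U;R)\to\mathfrak C^{\infty,X,\overline p}_*(U;R),$$ which sends $\xi$ to the family $(\langle\xi_K\rangle)_K$, where $\xi_K$ is any finite $\overline p$-intersection chain of $U$ that has the same coefficients as $\xi$ on all simplices meeting $K$, is a well-defined chain map and a quasi-isomorphism. -/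

import Mathlib

namespace BMIntersection

open CategoryTheory

universe u v

noncomputable section

open scoped Classical

section Spaces

variable {n : ℕ} {X : Type u} [TopologicalSpace X]

/-- A filtration `∅ = X₋₁ ⊆ X₀ ⊆ ⋯ ⊆ Xₙ = X` of a topological space by closed subsets. -/
structure Filtration (n : ℕ) (X : Type u) [TopologicalSpace X] where
  skel : Fin (n + 1) → Set X
  isClosed_skel : ∀ i, IsClosed (skel i)
  mono : Monotone skel
  skel_last : skel (Fin.last n) = Set.univ

/-- The difference `Xᵢ \ Xᵢ₋₁`. -/
def Filtration.layer (F : Filtration n X) (i : Fin (n + 1)) : Set X :=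
  {x | x ∈ F.skel i ∧ ∀ j < i, x ∉ F.skel j}

/-- A (non-empty) stratum: a dimension `i` together with a connected component of `Xᵢ \ Xᵢ₋₁`. -/
def Filtration.Stratum (F : Filtration n X) : Type u :=
  Σ i : Fin (n + 1), ConnectedComponents (F.layer i)

/-- The formal dimension of a stratum. -/
def Filtration.Stratum.dim {F : Filtration n X} (S : F.Stratum) : Fin (n + 1) := S.1

/-- The codimension of a stratum. -/
def Filtration.Stratum.codim {F : Filtration n X} (S : F.Stratum) : ℤ := (n : ℤ) - (S.dim : ℕ)

/-- The underlying subset of a stratum. -/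
def Filtration.Stratum.carrier {F : Filtration n X} (S : F.Stratum) : Set X :=
  {x | ∃ h : x ∈ F.layer S.1, ConnectedComponents.mk (⟨x, h⟩ : F.layer S.1) = S.2}

/-- A (general) perversity: an integer for each stratum, zero on the regular strata. -/
structure Perversity (F : Filtration n X) where
  toFun : F.Stratum → ℤ
  regular : ∀ S : F.Stratum, S.dim = Fin.last n → toFun S = 0

/-- The induced filtration on a subspace. -/
def Filtration.restrict (F : Filtration n X) (A : Set X) : Filtration n A where
  skel i := Subtype.val ⁻¹' F.skel i
  isClosed_skel i := (F.isClosed_skel i).preimage continuous_subtype_val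
  mono _ _ h := Set.preimage_mono (F.mono h)
  skel_last := by simp [F.skel_last]

/-- The inclusion of the layers of a subspace into the layers of the whole space. -/
def Filtration.layerInclusion (F : Filtration n X) (A : Set X) (i : Fin (n + 1)) :
    (F.restrict A).layer i → F.layer i :=
  fun x => ⟨x.1.1, x.2⟩

lemma Filtration.continuous_layerInclusion (F : Filtration n X) (A : Set X) (i : Fin (n + 1)) :
    Continuous (F.layerInclusion A i) :=
  (continuous_subtype_val.comp continuous_subtype_val).subtype_mk _

/-- The stratum of `X` that contains a given stratum of the subspace `A`. -/
def Filtration.Stratum.ambient {F : Filtration n X} {A : Set X} (S : (F.restrict A).Stratum) :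
    F.Stratum :=
  ⟨S.1, (F.continuous_layerInclusion A S.1).connectedComponentsMap S.2⟩

/-- The induced perversity on a subspace: `p(S) = p(S')` if `S ⊆ S'`. -/
def Perversity.restrict {F : Filtration n X} (p : Perversity F) (A : Set X) :
    Perversity (F.restrict A) where
  toFun S := p.toFun S.ambient
  regular S h := p.regular S.ambient h

lemma Filtration.Stratum.carrier_subset_ambient {F : Filtration n X} {A : Set X}
    (S : (F.restrict A).Stratum) : Subtype.val '' S.carrier ⊆ S.ambient.carrier := by
  rintro _ ⟨x, ⟨h, hx⟩, rfl⟩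
  refine ⟨h, ?_⟩
  have := congrArg (F.continuous_layerInclusion A S.1).connectedComponentsMap hx
  exact this

/-- Singular `k`-simplices, on the standard simplex with ordered vertices `e₀, …, e_k`. -/
abbrev Sing (k : ℕ) (X : Type u) [TopologicalSpace X] : Type u :=
  C(stdSimplex ℝ (Fin (k + 1)), X)

/-- The inclusion of the face of the standard simplex opposite to the `i`-th vertex. -/
def faceInclusion {k : ℕ} (i : Fin (k + 2)) :
    C(stdSimplex ℝ (Fin (k + 1)), stdSimplex ℝ (Fin (k + 2))) :=
  ⟨stdSimplex.map i.succAbove, stdSimplex.continuous_map _⟩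

/-- The face of a singular simplex opposite to the `i`-th vertex. -/
def Sing.face {k : ℕ} (i : Fin (k + 2)) (σ : Sing (k + 1) X) : Sing k X :=
  σ.comp (faceInclusion i)

/-- The simplex `σ` is regular: each `σ⁻¹(Xᵢ)` is a front face `Δ₀ * ⋯ * Δᵢ` of the simplex
(spanned by the vertices `eⱼ` with `j < m`, possibly empty), and `Δₙ` is not empty. -/
def Filtration.IsRegular (F : Filtration n X) {k : ℕ} (σ : Sing k X) : Prop :=
  (∀ i : Fin (n + 1), ∃ m : ℕ, ∀ t, σ t ∈ F.skel i ↔ ∀ j : Fin (k + 1), m ≤ j → t j = 0) ∧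
    ∃ t, σ t ∈ F.layer (Fin.last n)

/-- The dimension of `σ⁻¹(Xᵢ)` for a regular simplex `σ`: this set is the face spanned by the
vertices that it contains; the empty set has dimension `-∞`. -/
def Filtration.preimageDim (F : Filtration n X) {k : ℕ} (σ : Sing k X) (i : Fin (n + 1)) :
    WithBot ℤ :=
  if ∃ t, σ t ∈ F.skel i then
    (((Finset.univ.filter fun j : Fin (k + 1) => σ (stdSimplex.vertex j) ∈ F.skel i).card : ℤ) - 1
      : ℤ)
  else ⊥

/-- The perverse degree of a regular simplex along a stratum `S`. It is `-∞` if the simplex does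
not meet `S`, and the dimension of `σ⁻¹(X_{dim S})` otherwise. -/
def Filtration.perverseDegree (F : Filtration n X) {k : ℕ} (σ : Sing k X) (S : F.Stratum) :
    WithBot ℤ :=
  if ∃ t, σ t ∈ S.carrier then F.preimageDim σ S.dim else ⊥

/-- Allowable (regular) simplices. -/
def Perversity.IsAllowable {F : Filtration n X} (p : Perversity F) {k : ℕ} (σ : Sing k X) : Prop :=
  F.IsRegular σ ∧
    ∀ S : F.Stratum, F.perverseDegree σ S ≤ (((k : ℤ) - S.codim + p.toFun S : ℤ) : WithBot ℤ)

/-! ### Auxiliary facts on simplices -/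

lemma Sing.face_face {k : ℕ} (i : Fin (k + 3)) (j : Fin (k + 2)) (σ : Sing (k + 2) X) :
    Sing.face (j.predAbove i) (Sing.face (i.succAbove j) σ) = Sing.face j (Sing.face i σ) := by
  ext t
  simp only [Sing.face, faceInclusion, ContinuousMap.comp_apply, ContinuousMap.coe_mk,
    stdSimplex.map_comp_apply]
  congr 2
  ext k
  simp [Fin.succAbove_succAbove_succAbove_predAbove]

lemma Sing.face_apply {k : ℕ} (i : Fin (k + 2)) (σ : Sing (k + 1) X) (t) :
    Sing.face i σ t = σ (faceInclusion i t) := rfl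

lemma faceInclusion_vertex {k : ℕ} (i : Fin (k + 2)) (j : Fin (k + 1)) :
    faceInclusion i (stdSimplex.vertex j) = stdSimplex.vertex (i.succAbove j) :=
  stdSimplex.map_vertex _ _

/-- The inclusion of singular simplices of a subspace. -/
def Sing.push {A : Set X} {k : ℕ} (σ : Sing k A) : Sing k X :=
  (⟨Subtype.val, continuous_subtype_val⟩ : C(A, X)).comp σ

lemma Sing.push_apply {A : Set X} {k : ℕ} (σ : Sing k A) (t) : σ.push t = (σ t : X) := rfl

lemma Sing.push_injective {A : Set X} {k : ℕ} :
    Function.Injective (Sing.push : Sing k A → Sing k X) := by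
  intro σ τ h
  ext t
  exact congrArg (fun f : Sing k X => f t) h

lemma Sing.push_face {A : Set X} {k : ℕ} (i : Fin (k + 2)) (σ : Sing (k + 1) A) :
    (Sing.face i σ).push = Sing.face i σ.push := rfl

lemma Sing.exists_push {A : Set X} {k : ℕ} (σ : Sing k X) (h : ∀ t, σ t ∈ A) :
    ∃ τ : Sing k A, τ.push = σ :=
  ⟨⟨fun t => ⟨σ t, h t⟩, by fun_prop⟩, rfl⟩

lemma Filtration.isRegular_push (F : Filtration n X) {A : Set X} {k : ℕ} (σ : Sing k A) :
    F.IsRegular σ.push ↔ (F.restrict A).IsRegular σ := Iff.rfl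

lemma Filtration.preimageDim_push (F : Filtration n X) {A : Set X} {k : ℕ} (σ : Sing k A)
    (i : Fin (n + 1)) : F.preimageDim σ.push i = (F.restrict A).preimageDim σ i := rfl

lemma Perversity.isAllowable_push {F : Filtration n X} (p : Perversity F) {A : Set X} {k : ℕ}
    (σ : Sing k A) : p.IsAllowable σ.push ↔ (p.restrict A).IsAllowable σ := by
  refine and_congr (F.isRegular_push σ) ⟨fun h S => ?_, fun h S => ?_⟩
  · unfold Filtration.perverseDegree
    split_ifs with hS
    · obtain ⟨t, ht⟩ := hS
      have h1 := h S.ambient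
      unfold Filtration.perverseDegree at h1
      rw [if_pos ⟨t, S.carrier_subset_ambient ⟨_, ht, rfl⟩⟩] at h1
      exact h1
    · exact bot_le
  · unfold Filtration.perverseDegree
    split_ifs with hS
    · obtain ⟨t, ht, hS⟩ := hS
      obtain ⟨i, c⟩ := S
      have ht' : σ.push t ∈ F.layer i := ht
      replace hS : ConnectedComponents.mk (⟨σ.push t, ht'⟩ : F.layer i) = c := hS
      subst hS
      have h1 := h ⟨i, ConnectedComponents.mk ⟨σ t, ht'⟩⟩
      unfold Filtration.perverseDegree at h1
      rw [if_pos ⟨t, ht', rfl⟩] at h1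
      exact h1
    · exact bot_le

/-- A face of a regular simplex is regular if and only if it meets the regular part. -/
lemma Filtration.IsRegular.face_iff {F : Filtration n X} {k : ℕ} {σ : Sing (k + 1) X}
    (h : F.IsRegular σ) (i : Fin (k + 2)) :
    F.IsRegular (Sing.face i σ) ↔ ∃ t, Sing.face i σ t ∈ F.layer (Fin.last n) := by
  refine ⟨fun h' => h'.2, fun h' => ⟨fun a => ?_, h'⟩⟩
  obtain ⟨m, hm⟩ := h.1 a
  have key : ∀ (t : stdSimplex ℝ (Fin (k + 1))) (j : Fin (k + 1)),
      (faceInclusion i t) (i.succAbove j) = t j := by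
    intro t j
    change FunOnFinite.linearMap ℝ ℝ i.succAbove t (i.succAbove j) = t j
    rw [FunOnFinite.linearMap_apply_apply]
    rw [Finset.sum_eq_single j] <;> simp +contextual [Fin.succAbove_right_injective.eq_iff]
  have key' : ∀ (t : stdSimplex ℝ (Fin (k + 1))), (faceInclusion i t) i = 0 := by
    intro t
    change FunOnFinite.linearMap ℝ ℝ i.succAbove t i = 0
    rw [FunOnFinite.linearMap_apply_apply]
    apply Finset.sum_eq_zero
    intro j hj
    simp [Fin.succAbove_ne] at hj
  have h2 : ∀ t, Sing.face i σ t ∈ F.skel a ↔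
      ∀ j : Fin (k + 1), m ≤ ((i.succAbove j : Fin (k + 2)) : ℕ) → t j = 0 := by
    intro t
    rw [Sing.face_apply, hm]
    constructor
    · intro H j hj
      rw [← key]
      exact H _ hj
    · intro H j hj
      rcases Fin.eq_self_or_eq_succAbove i j with rfl | ⟨j, rfl⟩
      · exact key' t
      · rw [key]
        exact H j hj
  by_cases hi : (i : ℕ) < m
  · refine ⟨m - 1, fun t => (h2 t).trans (forall_congr' fun j => ?_)⟩
    have : m ≤ ((i.succAbove j : Fin (k + 2)) : ℕ) ↔ m - 1 ≤ (j : ℕ) := by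
      simp only [Fin.succAbove, Fin.lt_def]
      split_ifs with hc
      all_goals first | omega | (simp at hc ⊢; done) | (simp at hc ⊢; omega)
    rw [this]
  · refine ⟨m, fun t => (h2 t).trans (forall_congr' fun j => ?_)⟩
    have : m ≤ ((i.succAbove j : Fin (k + 2)) : ℕ) ↔ m ≤ (j : ℕ) := by
      simp only [Fin.succAbove, Fin.lt_def]
      split_ifs with hc
      all_goals first | omega | (simp at hc ⊢; done) | (simp at hc ⊢; omega)
    rw [this]

/-- A non-allowable regular face of an allowable simplex contains the first vertex. -/
lemma Perversity.IsAllowable.face_zero_vertex {F : Filtration n X} {p : Perversity F} {k : ℕ}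
    {σ : Sing (k + 1) X} (h : p.IsAllowable σ) (i : Fin (k + 2))
    (hreg : ∃ t, Sing.face i σ t ∈ F.layer (Fin.last n))
    (hna : ¬ p.IsAllowable (Sing.face i σ)) :
    Sing.face i σ (stdSimplex.vertex 0) = σ (stdSimplex.vertex 0) := by
  by_cases hi : i = 0
  swap
  · rw [Sing.face_apply, faceInclusion_vertex, Fin.succAbove_ne_zero_zero hi]
  exfalso
  subst hi
  refine hna ⟨(h.1.face_iff 0).2 hreg, fun S => ?_⟩
  unfold Filtration.perverseDegree
  split_ifs with hS
  swap
  · exact bot_le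
  obtain ⟨t, ht⟩ := hS
  have h1 := h.2 S
  unfold Filtration.perverseDegree at h1
  rw [if_pos ⟨faceInclusion 0 t, ht⟩] at h1
  obtain ⟨hl, -⟩ := ht
  have hsk : Sing.face 0 σ t ∈ F.skel S.dim := hl.1
  unfold Filtration.preimageDim at h1 ⊢
  rw [if_pos ⟨faceInclusion 0 t, hsk⟩] at h1
  rw [if_pos ⟨t, hsk⟩]
  rw [WithBot.coe_le_coe] at h1 ⊢
  obtain ⟨m, hm⟩ := h.1.1 S.dim
  have hm0 : 0 < m := by
    by_contra h0
    have h2 := (hm (faceInclusion 0 t)).1 hsk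
    have h3 := stdSimplex.sum_eq_one (faceInclusion (0 : Fin (k + 2)) t)
    rw [Finset.sum_eq_zero fun j _ => h2 j (by omega)] at h3
    exact zero_ne_one h3
  have hv0 : σ (stdSimplex.vertex 0) ∈ F.skel S.dim := by
    rw [hm]
    intro j hj
    have : j ≠ 0 := by
      rintro rfl
      simp at hj
      omega
    simp [stdSimplex.vertex_coe, this]
  have hcard : (Finset.univ.filter fun j : Fin (k + 2) =>
      σ (stdSimplex.vertex j) ∈ F.skel S.dim).card =
      (Finset.univ.filter fun j : Fin (k + 1) =>
        Sing.face 0 σ (stdSimplex.vertex j) ∈ F.skel S.dim).card + 1 := by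
    rw [Fin.card_filter_univ_succ, if_pos hv0]
    congr 2
    ext j
    simp only [Finset.mem_filter, Finset.mem_univ, true_and, Sing.face_apply,
      faceInclusion_vertex, Fin.succAbove_zero]
  rw [hcard] at h1
  push_cast at h1 ⊢
  linarith

end Spaces

section Chains

lemma exists_of_finsum_ne_zero {α : Type*} {M : Type*} [AddCommMonoid M] {f : α → M}
    (h : ∑ᶠ a, f a ≠ 0) : ∃ a, f a ≠ 0 := by
  by_contra! H
  exact h (by simp [H])

variable {n : ℕ} {X : Type u} [TopologicalSpace X] (R : Type v) [CommRing R]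

/-- The differential of a regular simplex: the regular part of the alternating sum of its faces
(faces that do not meet the regular part of `X` are dropped). -/
def Filtration.bd (F : Filtration n X) {k : ℕ} (σ : Sing (k + 1) X) : Sing k X →₀ R :=
  ∑ i : Fin (k + 2), if ∃ t, Sing.face i σ t ∈ F.layer (Fin.last n) then
    Finsupp.single (Sing.face i σ) ((-1) ^ (i : ℕ)) else 0

/-- The differential on finite chains, the linear extension of `bd`. -/
def Filtration.finBd (F : Filtration n X) (k : ℕ) :
    (Sing (k + 1) X →₀ R) →ₗ[R] (Sing k X →₀ R) :=
  Finsupp.linearCombination R (F.bd R)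

lemma Filtration.exists_face_of_bd_ne_zero {F : Filtration n X} {k : ℕ} {σ : Sing (k + 1) X}
    {τ : Sing k X} (h : F.bd R σ τ ≠ 0) :
    ∃ i, Sing.face i σ = τ ∧ ∃ t, τ t ∈ F.layer (Fin.last n) := by
  by_contra! H
  apply h
  rw [Filtration.bd, Finsupp.finsetSum_apply]
  refine Finset.sum_eq_zero fun i _ => ?_
  split_ifs with hi
  · rw [Finsupp.single_apply, if_neg]
    rintro rfl
    obtain ⟨t, ht⟩ := hi
    exact H i rfl t ht
  · rfl

lemma Filtration.finBd_bd (F : Filtration n X) {k : ℕ} (σ : Sing (k + 2) X) :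
    F.finBd R k (F.bd R σ) = 0 := by
  have h1 : F.finBd R k (F.bd R σ) = ∑ ij : Fin (k + 3) × Fin (k + 2),
      if ∃ t, Sing.face ij.2 (Sing.face ij.1 σ) t ∈ F.layer (Fin.last n) then
        Finsupp.single (Sing.face ij.2 (Sing.face ij.1 σ))
          ((-1 : R) ^ (ij.1 + ij.2 : ℕ)) else 0 := by
    rw [Fintype.sum_prod_type]
    conv_lhs => rw [Filtration.bd]
    rw [map_sum]
    refine Finset.sum_congr rfl fun i _ => ?_
    split_ifs with hi
    · rw [Filtration.finBd, Finsupp.linearCombination_single, Filtration.bd, Finset.smul_sum]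
      refine Finset.sum_congr rfl fun j _ => ?_
      rw [smul_ite, smul_zero, Finsupp.smul_single, smul_eq_mul, pow_add]
    · rw [map_zero, Finset.sum_eq_zero]
      intro j _
      rw [if_neg]
      rintro ⟨t, ht⟩
      exact hi ⟨_, ht⟩
  rw [h1]
  refine Finset.sum_involution (fun ij _ => (ij.1.succAbove ij.2, ij.2.predAbove ij.1))
    ?_ ?_ ?_ ?_
  · rintro ⟨i, j⟩ -
    simp only [Sing.face_face]
    split_ifs
    · rw [← Finsupp.single_add, Fin.neg_one_pow_succAbove_add_predAbove, add_neg_cancel,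
        Finsupp.single_zero]
    · simp
  · rintro ⟨i, j⟩ - -
    simp [Fin.succAbove_ne]
  · intros
    exact Finset.mem_univ _
  · rintro ⟨i, j⟩ -
    simp [Fin.succAbove_succAbove_predAbove, Fin.predAbove_predAbove_succAbove]

lemma Filtration.finBd_finBd (F : Filtration n X) (k : ℕ) :
    F.finBd R k ∘ₗ F.finBd R (k + 1) = 0 := by
  refine Finsupp.lhom_ext' fun σ => LinearMap.ext_ring ?_
  simp only [LinearMap.comp_apply, Finsupp.lsingle_apply, LinearMap.zero_apply]
  conv_lhs => rw [Filtration.finBd, Filtration.finBd]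
  rw [Finsupp.linearCombination_single, one_smul]
  exact F.finBd_bd R σ

lemma Filtration.finBd_apply (F : Filtration n X) {k : ℕ} (c : Sing (k + 1) X →₀ R)
    (τ : Sing k X) : F.finBd R k c τ = ∑ᶠ σ, c σ * F.bd R σ τ := by
  rw [Filtration.finBd, Finsupp.linearCombination_apply, Finsupp.sum_apply, Finsupp.sum,
    finsum_eq_sum_of_support_subset]
  · rfl
  · intro σ hσ
    simp only [Function.mem_support] at hσ
    simpa using left_ne_zero_of_mul hσ

/-- The differential of an arbitrary formal linear combination `∑ λⱼ σⱼ` of simplices, given by its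
coefficients; the sums are finite for locally finite chains. -/
def Filtration.lfBd (F : Filtration n X) {k : ℕ} (ξ : Sing (k + 1) X → R) : Sing k X → R :=
  fun τ => ∑ᶠ σ, ξ σ * F.bd R σ τ

/-- Locally finite chains: each point of `X` has a neighbourhood that meets only finitely many
simplices of the chain. -/
def lfChains (k : ℕ) (X : Type u) [TopologicalSpace X] : Submodule R (Sing k X → R) where
  carrier := {ξ | ∀ x : X, ∃ V ∈ nhds x, {σ | ξ σ ≠ 0 ∧ ∃ t, σ t ∈ V}.Finite}
  zero_mem' := fun x => ⟨Set.univ, Filter.univ_mem, by simp⟩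
  add_mem' := by
    intro ξ η hξ hη x
    obtain ⟨V, hV, hV'⟩ := hξ x
    obtain ⟨W, hW, hW'⟩ := hη x
    refine ⟨V ∩ W, Filter.inter_mem hV hW, (hV'.union hW').subset ?_⟩
    rintro σ ⟨h, t, ht⟩
    by_cases h1 : ξ σ = 0
    · exact Or.inr ⟨fun h2 => h (by simp [h1, h2]), t, ht.2⟩
    · exact Or.inl ⟨h1, t, ht.1⟩
  smul_mem' := by
    intro r ξ hξ x
    obtain ⟨V, hV, hV'⟩ := hξ x
    refine ⟨V, hV, hV'.subset ?_⟩
    rintro σ ⟨h, t, ht⟩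
    exact ⟨fun h2 => h (by simp [h2]), t, ht⟩

variable {R}

/-- The part of a chain carried by a finite set of simplices. -/
def truncate {k : ℕ} (ξ : Sing k X → R) {A : Set (Sing k X)} (hA : A.Finite) : Sing k X →₀ R :=
  Finsupp.onFinset hA.toFinset (fun σ => if σ ∈ A then ξ σ else 0) (by
    intro σ h
    simpa using fun h' => h (if_neg h'))

lemma truncate_apply {k : ℕ} (ξ : Sing k X → R) {A : Set (Sing k X)} (hA : A.Finite) (σ) :
    truncate ξ hA σ = if σ ∈ A then ξ σ else 0 := rfl

lemma Filtration.lfBd_eq_finBd (F : Filtration n X) {k : ℕ} {ξ : Sing (k + 1) X → R}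
    {c : Sing (k + 1) X →₀ R} {τ : Sing k X}
    (h : ∀ i σ, Sing.face i σ = τ → c σ = ξ σ) : F.lfBd R ξ τ = F.finBd R k c τ := by
  rw [F.finBd_apply R]
  refine finsum_congr fun σ => ?_
  by_cases h0 : F.bd R σ τ = 0
  · simp [h0]
  · obtain ⟨i, hi, -⟩ := Filtration.exists_face_of_bd_ne_zero R h0
    rw [h i σ hi]

lemma lfChains.exists_finsupp {k : ℕ} {ξ : Sing k X → R} (hξ : ξ ∈ lfChains R k X) (x : X) :
    ∃ V ∈ nhds x, ∃ c : Sing k X →₀ R, ∀ σ, (∃ t, σ t ∈ V) → c σ = ξ σ := by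
  obtain ⟨V, hV, hV'⟩ := hξ x
  refine ⟨V, hV, truncate ξ hV', fun σ hσ => ?_⟩
  rw [truncate_apply]
  split_ifs with h
  · rfl
  · by_contra h'
    exact h ⟨fun h2 => h' h2.symm, hσ⟩

lemma lfChains.exists_finsupp_face {k : ℕ} {ξ : Sing (k + 1) X → R}
    (hξ : ξ ∈ lfChains R (k + 1) X) (x : X) : ∃ V ∈ nhds x, ∃ c : Sing (k + 1) X →₀ R,
      (∀ σ, (∃ t, σ t ∈ V) → c σ = ξ σ) ∧
      ∀ (F : Filtration n X) (τ : Sing k X), (∃ t, τ t ∈ V) → F.lfBd R ξ τ = F.finBd R k c τ := by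
  obtain ⟨V, hV, c, hc⟩ := lfChains.exists_finsupp hξ x
  refine ⟨V, hV, c, hc, fun F τ hτ => F.lfBd_eq_finBd ?_⟩
  rintro i σ rfl
  obtain ⟨t, ht⟩ := hτ
  exact hc σ ⟨_, ht⟩

variable (R)

/-- The differential on locally finite chains. -/
def Filtration.lfBdMap (F : Filtration n X) (k : ℕ) :
    lfChains R (k + 1) X →ₗ[R] lfChains R k X where
  toFun ξ := ⟨F.lfBd R ξ.1, fun x => by
    obtain ⟨V, hV, c, -, hc⟩ := lfChains.exists_finsupp_face (n := n) ξ.2 x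
    refine ⟨V, hV, (F.finBd R k c).support.finite_toSet.subset ?_⟩
    rintro τ ⟨h, hτ⟩
    rw [hc F τ hτ] at h
    simpa using h⟩
  map_add' ξ η := by
    refine Subtype.ext (funext fun τ => ?_)
    obtain ⟨V, hV, c, hc, -⟩ := lfChains.exists_finsupp_face (n := n) ξ.2 (τ (stdSimplex.vertex 0))
    obtain ⟨W, hW, d, hd, -⟩ := lfChains.exists_finsupp_face (n := n) η.2 (τ (stdSimplex.vertex 0))
    change F.lfBd R (ξ.1 + η.1) τ = F.lfBd R ξ.1 τ + F.lfBd R η.1 τ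
    have hV' := mem_of_mem_nhds hV
    have hW' := mem_of_mem_nhds hW
    rw [F.lfBd_eq_finBd (c := c) (ξ := ξ.1), F.lfBd_eq_finBd (c := d) (ξ := η.1),
      F.lfBd_eq_finBd (c := c + d), map_add, Finsupp.add_apply]
    · rintro i σ rfl
      rw [Finsupp.add_apply, hc σ ⟨_, hV'⟩, hd σ ⟨_, hW'⟩]
      rfl
    · rintro i σ rfl
      exact hd σ ⟨_, hW'⟩
    · rintro i σ rfl
      exact hc σ ⟨_, hV'⟩
  map_smul' r ξ := by
    refine Subtype.ext (funext fun τ => ?_)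
    obtain ⟨V, hV, c, hc, -⟩ := lfChains.exists_finsupp_face (n := n) ξ.2 (τ (stdSimplex.vertex 0))
    change F.lfBd R (r • ξ.1) τ = r • F.lfBd R ξ.1 τ
    have hV' := mem_of_mem_nhds hV
    rw [F.lfBd_eq_finBd (c := c) (ξ := ξ.1), F.lfBd_eq_finBd (c := r • c), map_smul,
      Finsupp.smul_apply]
    · rintro i σ rfl
      rw [Finsupp.smul_apply, hc σ ⟨_, hV'⟩]
      rfl
    · rintro i σ rfl
      exact hc σ ⟨_, hV'⟩

lemma Filtration.lfBdMap_lfBdMap (F : Filtration n X) (k : ℕ) :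
    F.lfBdMap R k ∘ₗ F.lfBdMap R (k + 1) = 0 := by
  refine LinearMap.ext fun ξ => Subtype.ext (funext fun τ => ?_)
  change F.lfBd R (F.lfBd R ξ.1) τ = 0
  obtain ⟨V, hV, c, -, hc⟩ := lfChains.exists_finsupp_face (n := n) ξ.2 (τ (stdSimplex.vertex 0))
  rw [F.lfBd_eq_finBd (c := F.finBd R (k + 1) c)]
  · exact DFunLike.congr_fun (LinearMap.congr_fun (F.finBd_finBd R k) c) τ
  · rintro i σ rfl
    exact (hc F σ ⟨_, mem_of_mem_nhds hV⟩).symm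

variable {F : Filtration n X} (p : Perversity F)

/-! ### Intersection chains -/

/-- Finite allowable chains. -/
def Perversity.allowableChains (k : ℕ) : Submodule R (Sing k X →₀ R) :=
  Finsupp.supported R R {σ | p.IsAllowable σ}

/-- Finite `p`-intersection chains: the chain and its differential are allowable. -/
def Perversity.chains : (k : ℕ) → Submodule R (Sing k X →₀ R)
  | 0 => p.allowableChains R 0
  | k + 1 => p.allowableChains R (k + 1) ⊓ (p.allowableChains R k).comap (F.finBd R k)

/-- Locally finite allowable chains. -/
def Perversity.lfAllowableChains (k : ℕ) : Submodule R (lfChains R k X) where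
  carrier := {ξ | ∀ σ, ξ.1 σ ≠ 0 → p.IsAllowable σ}
  zero_mem' := fun σ h => absurd rfl h
  add_mem' := by
    intro ξ η hξ hη σ h
    by_cases h1 : ξ.1 σ = 0
    · exact hη σ fun h2 => h (by change ξ.1 σ + η.1 σ = 0; simp [h1, h2])
    · exact hξ σ h1
  smul_mem' := by
    intro r ξ hξ σ h
    exact hξ σ fun h2 => h (by change r • ξ.1 σ = 0; simp [h2])

/-- Locally finite `p`-intersection chains: the chain and its differential are allowable. -/
def Perversity.lfInterChains : (k : ℕ) → Submodule R (lfChains R k X)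
  | 0 => p.lfAllowableChains R 0
  | k + 1 => p.lfAllowableChains R (k + 1) ⊓ (p.lfAllowableChains R k).comap (F.lfBdMap R k)

variable {R}

lemma Perversity.chains_le (k : ℕ) : p.chains R k ≤ p.allowableChains R k := by
  cases k with
  | zero => exact le_rfl
  | succ k => exact inf_le_left

lemma Perversity.lfInterChains_le (k : ℕ) : p.lfInterChains R k ≤ p.lfAllowableChains R k := by
  cases k with
  | zero => exact le_rfl
  | succ k => exact inf_le_left

lemma Perversity.mem_allowableChains {k : ℕ} {c : Sing k X →₀ R} :
    c ∈ p.allowableChains R k ↔ ∀ σ, c σ ≠ 0 → p.IsAllowable σ := by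
  rw [Perversity.allowableChains, Finsupp.mem_supported]
  simp [Set.subset_def]

lemma Perversity.finBd_mem {k : ℕ} {c : Sing (k + 1) X →₀ R} (hc : c ∈ p.chains R (k + 1)) :
    F.finBd R k c ∈ p.chains R k := by
  cases k with
  | zero => exact hc.2
  | succ k =>
    refine ⟨hc.2, ?_⟩
    have h : F.finBd R k (F.finBd R (k + 1) c) = 0 :=
      LinearMap.congr_fun (F.finBd_finBd R k) c
    refine Submodule.mem_comap.2 ?_
    rw [h]
    exact zero_mem _

lemma Perversity.lfBdMap_mem {k : ℕ} {ξ : lfChains R (k + 1) X}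
    (hξ : ξ ∈ p.lfInterChains R (k + 1)) : F.lfBdMap R k ξ ∈ p.lfInterChains R k := by
  cases k with
  | zero => exact hξ.2
  | succ k =>
    refine ⟨hξ.2, ?_⟩
    have h : F.lfBdMap R k (F.lfBdMap R (k + 1) ξ) = 0 :=
      LinearMap.congr_fun (F.lfBdMap_lfBdMap R k) ξ
    refine Submodule.mem_comap.2 ?_
    rw [h]
    exact zero_mem _

variable (R)

/-- The module of finite `p`-intersection chains. -/
def Perversity.Chains (k : ℕ) : Type (max u v) := p.chains R k

instance Perversity.instAddCommGroupChains (k : ℕ) : AddCommGroup (p.Chains R k) :=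
  inferInstanceAs (AddCommGroup (p.chains R k))

instance Perversity.instModuleChains (k : ℕ) : Module R (p.Chains R k) :=
  inferInstanceAs (Module R (p.chains R k))

/-- The inclusion of the `p`-intersection chains into all finite chains. -/
def Perversity.val (k : ℕ) : p.Chains R k →ₗ[R] (Sing k X →₀ R) := (p.chains R k).subtype

/-- The differential of the complex of finite `p`-intersection chains. -/
def Perversity.d (k : ℕ) : p.Chains R (k + 1) →ₗ[R] p.Chains R k :=
  (F.finBd R k).restrict fun _ hc => p.finBd_mem hc

/-- The differential of the complex of locally finite `p`-intersection chains. -/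
def Perversity.lfD (k : ℕ) : p.lfInterChains R (k + 1) →ₗ[R] p.lfInterChains R k :=
  (F.lfBdMap R k).restrict fun _ hξ => p.lfBdMap_mem hξ

lemma Perversity.d_d (k : ℕ) : p.d R k ∘ₗ p.d R (k + 1) = 0 :=
  LinearMap.ext fun c => Subtype.ext (LinearMap.congr_fun (F.finBd_finBd R k) c.1)

lemma Perversity.lfD_lfD (k : ℕ) : p.lfD R k ∘ₗ p.lfD R (k + 1) = 0 :=
  LinearMap.ext fun ξ => Subtype.ext (LinearMap.congr_fun (F.lfBdMap_lfBdMap R k) ξ.1)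

/-- The complex of locally finite `p`-intersection chains. -/
def Perversity.lfComplex : ChainComplex (ModuleCat.{max u v} R) ℕ :=
  ChainComplex.of (fun k => ModuleCat.of R (p.lfInterChains R k))
    (fun k => ModuleCat.ofHom (p.lfD R k)) fun k => by
      rw [← ModuleCat.ofHom_comp, p.lfD_lfD R]
      rfl

/-! ### Relative chains -/

/-- The linear map on finite chains induced by the inclusion of a subspace. -/
def pushChain (A : Set X) (k : ℕ) : (Sing k A →₀ R) →ₗ[R] (Sing k X →₀ R) :=
  Finsupp.lmapDomain R R Sing.push

variable {R}

lemma pushChain_injective (A : Set X) (k : ℕ) : Function.Injective (pushChain R A k) :=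
  Finsupp.mapDomain_injective Sing.push_injective

lemma pushChain_apply_push {A : Set X} {k : ℕ} (c : Sing k A →₀ R) (σ : Sing k A) :
    pushChain R A k c σ.push = c σ :=
  Finsupp.mapDomain_apply Sing.push_injective c σ

lemma exists_of_pushChain_ne_zero {A : Set X} {k : ℕ} {c : Sing k A →₀ R} {σ : Sing k X}
    (h : pushChain R A k c σ ≠ 0) : ∃ τ : Sing k A, τ.push = σ := by
  by_contra H
  exact h (Finsupp.mapDomain_of_notMem_range c σ fun ⟨τ, hτ⟩ => H ⟨τ, hτ⟩)

lemma finBd_pushChain (F : Filtration n X) {A : Set X} {k : ℕ} (c : Sing (k + 1) A →₀ R) :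
    F.finBd R k (pushChain R A (k + 1) c) = pushChain R A k ((F.restrict A).finBd R k c) := by
  suffices h : F.finBd R k ∘ₗ pushChain R A (k + 1) =
      pushChain R A k ∘ₗ (F.restrict A).finBd R k from LinearMap.congr_fun h c
  refine Finsupp.lhom_ext' fun σ => LinearMap.ext_ring ?_
  simp only [LinearMap.comp_apply, Finsupp.lsingle_apply, Filtration.finBd, pushChain,
    Finsupp.lmapDomain_apply, Finsupp.mapDomain_single, Finsupp.linearCombination_single, one_smul]
  rw [Filtration.bd, Filtration.bd, Finsupp.mapDomain_finsetSum]
  refine Finset.sum_congr rfl fun i _ => ?_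
  rw [apply_ite (Finsupp.mapDomain Sing.push), Finsupp.mapDomain_single, Finsupp.mapDomain_zero]
  rfl

lemma Perversity.pushChain_mem_allowableChains {A : Set X} {k : ℕ} (c : Sing k A →₀ R) :
    pushChain R A k c ∈ p.allowableChains R k ↔ c ∈ (p.restrict A).allowableChains R k := by
  rw [p.mem_allowableChains, (p.restrict A).mem_allowableChains]
  constructor
  · intro h σ hσ
    rw [← p.isAllowable_push]
    exact h _ (by rwa [pushChain_apply_push])
  · intro h σ hσ
    obtain ⟨τ, rfl⟩ := exists_of_pushChain_ne_zero hσ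
    rw [p.isAllowable_push]
    exact h _ (by rwa [pushChain_apply_push] at hσ)

lemma Perversity.pushChain_mem {A : Set X} {k : ℕ} (c : Sing k A →₀ R) :
    pushChain R A k c ∈ p.chains R k ↔ c ∈ (p.restrict A).chains R k := by
  cases k with
  | zero => exact p.pushChain_mem_allowableChains c
  | succ k =>
    refine and_congr (p.pushChain_mem_allowableChains c) ?_
    simp only [SetLike.mem_coe, Submodule.mem_comap]
    rw [finBd_pushChain, p.pushChain_mem_allowableChains]

variable (R)

/-- The image of the `p`-intersection chains of a subspace `A` (with the induced structure) in the
`p`-intersection chains of `X`. -/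
def Perversity.subChains (A : Set X) (k : ℕ) : Submodule R (p.Chains R k) :=
  (((p.restrict A).chains R k).map (pushChain R A k)).comap (p.val R k)

variable {R}

lemma Perversity.mem_subChains {A : Set X} {k : ℕ} {c : p.Chains R k} :
    c ∈ p.subChains R A k ↔ ∀ σ, c.1 σ ≠ 0 → ∀ t, σ t ∈ A := by
  constructor
  · rintro ⟨c', -, hc'⟩ σ hσ t
    have hσ' : pushChain R A k c' σ ≠ 0 := by
      rw [hc']
      exact hσ
    obtain ⟨τ, rfl⟩ := exists_of_pushChain_ne_zero hσ'
    exact (τ t).2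
  · intro h
    obtain ⟨c', hc'⟩ : ∃ c', pushChain R A k c' = c.1 := by
      refine ⟨Finsupp.comapDomain Sing.push c.1 Sing.push_injective.injOn, ?_⟩
      refine Finsupp.mapDomain_comapDomain _ Sing.push_injective _ ?_
      intro σ hσ
      exact Sing.exists_push σ (h σ (by simpa using hσ))
    refine ⟨c', ?_, hc'⟩
    change c' ∈ (p.restrict A).chains R k
    rw [← p.pushChain_mem, hc']
    exact c.2

lemma Perversity.subChains_mono {A B : Set X} (h : A ⊆ B) (k : ℕ) :
    p.subChains R A k ≤ p.subChains R B k := fun _ hc =>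
  p.mem_subChains.2 fun σ hσ t => h (p.mem_subChains.1 hc σ hσ t)

lemma Perversity.d_mem_subChains (A : Set X) (k : ℕ) :
    p.subChains R A (k + 1) ≤ (p.subChains R A k).comap (p.d R k) := by
  intro c hc
  rw [Submodule.mem_comap, p.mem_subChains]
  intro τ hτ t
  change F.finBd R k c.1 τ ≠ 0 at hτ
  rw [F.finBd_apply R] at hτ
  obtain ⟨σ, hσ⟩ := exists_of_finsum_ne_zero hτ
  obtain ⟨i, rfl, -⟩ := Filtration.exists_face_of_bd_ne_zero R (right_ne_zero_of_mul hσ)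
  exact p.mem_subChains.1 hc σ (left_ne_zero_of_mul hσ) _

variable (R)

/-- Relative `p`-intersection chains of the pair `(X, A)`. -/
abbrev Perversity.RelChains (A : Set X) (k : ℕ) : Type (max u v) :=
  p.Chains R k ⧸ p.subChains R A k

/-- The differential on relative chains. -/
def Perversity.relD (A : Set X) (k : ℕ) : p.RelChains R A (k + 1) →ₗ[R] p.RelChains R A k :=
  Submodule.mapQ _ _ (p.d R k) (p.d_mem_subChains A k)

lemma Perversity.relD_relD (A : Set X) (k : ℕ) : p.relD R A k ∘ₗ p.relD R A (k + 1) = 0 := by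
  refine Submodule.linearMap_qext _ (LinearMap.ext fun c => ?_)
  change Submodule.Quotient.mk (p.d R k (p.d R (k + 1) c)) = 0
  rw [← LinearMap.comp_apply, p.d_d R]
  rfl

/-- The map of relative chains induced by the identity of `X`, for `A ⊆ B`. -/
def Perversity.relMap {A B : Set X} (h : A ⊆ B) (k : ℕ) :
    p.RelChains R A k →ₗ[R] p.RelChains R B k :=
  Submodule.factor (p.subChains_mono h k)

/-! ### The inverse limit over the compact subsets of `U` -/

/-- Compact subsets of `X` that are contained in `U`. -/
def CompactIn (U : Set X) : Type u := {K : Set X // IsCompact K ∧ K ⊆ U}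

/-- The inverse limit, over the compact subsets `K` of `U`, of the relative chains of
`(X, X \ K)`: compatible families of relative chains. -/
def Perversity.limChains (U : Set X) (k : ℕ) :
    Submodule R (∀ K : CompactIn U, p.RelChains R K.1ᶜ k) where
  carrier := {α | ∀ (K K' : CompactIn U) (h : K.1 ⊆ K'.1),
    p.relMap R (Set.compl_subset_compl.2 h) k (α K') = α K}
  zero_mem' := fun _ _ _ => map_zero _
  add_mem' := fun {α β} hα hβ K K' h => by
    rw [Pi.add_apply, Pi.add_apply, map_add, hα K K' h, hβ K K' h]
  smul_mem' := fun r α hα K K' h => by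
    rw [Pi.smul_apply, Pi.smul_apply, map_smul, hα K K' h]

lemma Perversity.relD_relMap {A B : Set X} (h : A ⊆ B) (k : ℕ) (c : p.RelChains R A (k + 1)) :
    p.relD R B k (p.relMap R h (k + 1) c) = p.relMap R h k (p.relD R A k c) := by
  obtain ⟨c, rfl⟩ := Submodule.Quotient.mk_surjective _ c
  rfl

/-- The differential on the inverse limit. -/
def Perversity.limD (U : Set X) (k : ℕ) : p.limChains R U (k + 1) →ₗ[R] p.limChains R U k :=
  (LinearMap.pi fun K : CompactIn U => p.relD R K.1ᶜ k ∘ₗ LinearMap.proj K).restrict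
    fun α hα K K' h => by
      change p.relMap R _ k (p.relD R K'.1ᶜ k (α K')) = p.relD R K.1ᶜ k (α K)
      rw [← p.relD_relMap R, hα K K' h]

lemma Perversity.limD_limD (U : Set X) (k : ℕ) : p.limD R U k ∘ₗ p.limD R U (k + 1) = 0 :=
  LinearMap.ext fun α => Subtype.ext (funext fun K =>
    LinearMap.congr_fun (p.relD_relD R K.1ᶜ k) (α.1 K))

/-- The complex `lim_{K ⊆ U} C(X, X \ K)`, with `K` running over the compact subsets of `U`. -/
def Perversity.limComplex (U : Set X) : ChainComplex (ModuleCat.{max u v} R) ℕ :=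
  ChainComplex.of (fun k => ModuleCat.of R (p.limChains R U k))
    (fun k => ModuleCat.ofHom (p.limD R U k)) fun k => by
      rw [← ModuleCat.ofHom_comp, p.limD_limD R]
      rfl

/-! ### The natural restriction -/

variable {R}

lemma lfChains.finite_meets {k : ℕ} {ξ : Sing k X → R} (hξ : ξ ∈ lfChains R k X) {K : Set X}
    (hK : IsCompact K) : {σ | ξ σ ≠ 0 ∧ ∃ t, σ t ∈ K}.Finite := by
  choose V hV hV' using hξ
  obtain ⟨s, -, hs⟩ := hK.elim_nhds_subcover V fun x _ => hV x
  refine (s.finite_toSet.biUnion fun x _ => hV' x).subset ?_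
  rintro σ ⟨h, t, ht⟩
  obtain ⟨x, hx, hx'⟩ := Set.mem_iUnion₂.1 (hs ht)
  exact Set.mem_iUnion₂.2 ⟨x, hx, h, t, hx'⟩

/-- Near a compact set, a locally finite `p`-intersection chain is given by a finite
`p`-intersection chain. -/
lemma Perversity.exists_finite_chain {k : ℕ} {ξ : lfChains R k X} (hξ : ξ ∈ p.lfInterChains R k)
    {K : Set X} (hK : IsCompact K) :
    ∃ c ∈ p.chains R k, ∀ σ, (∃ t, σ t ∈ K) → c σ = ξ.1 σ := by
  let v : Sing k X → X := fun σ => σ (stdSimplex.vertex 0)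
  have hA₀ := lfChains.finite_meets ξ.2 hK
  let B : Set X := v '' {σ | ξ.1 σ ≠ 0 ∧ ∃ t, σ t ∈ K}
  have hB : B.Finite := hA₀.image _
  have hA : {σ | ξ.1 σ ≠ 0 ∧ v σ ∈ B}.Finite :=
    (lfChains.finite_meets ξ.2 hB.isCompact).subset fun σ hσ => ⟨hσ.1, _, hσ.2⟩
  have hval : ∀ σ, v σ ∈ B → truncate ξ.1 hA σ = ξ.1 σ := by
    intro σ hσ
    rw [truncate_apply]
    split_ifs with h
    · rfl
    · by_contra h'
      exact h ⟨fun h2 => h' h2.symm, hσ⟩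
  have hval' : ∀ σ, truncate ξ.1 hA σ ≠ 0 → ξ.1 σ ≠ 0 ∧ v σ ∈ B := by
    intro σ hσ
    by_contra h
    exact hσ (if_neg h)
  have hall : truncate ξ.1 hA ∈ p.allowableChains R k :=
    p.mem_allowableChains.2 fun σ hσ => p.lfInterChains_le k hξ σ (hval' σ hσ).1
  refine ⟨truncate ξ.1 hA, ?_, fun σ hσ => ?_⟩
  · cases k with
    | zero => exact hall
    | succ k =>
      refine ⟨hall, ?_⟩
      change F.finBd R k (truncate ξ.1 hA) ∈ p.allowableChains R k
      rw [p.mem_allowableChains]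
      intro τ hτ
      by_contra hna
      have hface : ∀ σ, ξ.1 σ ≠ 0 → F.bd R σ τ ≠ 0 → v σ = τ (stdSimplex.vertex 0) := by
        intro σ h1 h2
        obtain ⟨i, rfl, h4⟩ := Filtration.exists_face_of_bd_ne_zero R h2
        exact ((p.lfInterChains_le _ hξ σ h1).face_zero_vertex i h4 hna).symm
      by_cases hτB : τ (stdSimplex.vertex 0) ∈ B
      · refine hna (hξ.2 τ ?_)
        change F.lfBd R ξ.1 τ ≠ 0
        convert hτ using 1
        rw [F.finBd_apply R]
        refine finsum_congr fun σ => ?_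
        by_cases h0 : F.bd R σ τ = 0
        · simp [h0]
        by_cases h1 : ξ.1 σ = 0
        · rw [h1, truncate_apply, h1, ite_self]
        rw [hval σ (by rw [hface σ h1 h0]; exact hτB)]
      · rw [F.finBd_apply R] at hτ
        obtain ⟨σ, hσ⟩ := exists_of_finsum_ne_zero hτ
        obtain ⟨h1, h2⟩ := hval' σ (left_ne_zero_of_mul hσ)
        rw [hface σ h1 (right_ne_zero_of_mul hσ)] at h2
        exact hτB h2
  · by_cases h : ξ.1 σ = 0
    · rw [truncate_apply, h, ite_self]
    · exact hval σ ⟨σ, ⟨h, hσ⟩, rfl⟩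

lemma isCompact_preimage {U : Set X} (K : CompactIn U) :
    IsCompact (Subtype.val ⁻¹' K.1 : Set U) :=
  (Topology.IsEmbedding.subtypeVal.isCompact_preimage_iff (by simpa using K.2.2)).2 K.2.1

/-- For a locally finite `p`-intersection chain `ξ` of the subspace `U` and a compact `K ⊆ U`, a
finite `p`-intersection chain of `U` with the same coefficients as `ξ` on all simplices that
meet `K`. -/
def Perversity.finitePart {U : Set X} {k : ℕ} (ξ : (p.restrict U).lfInterChains R k)
    (K : CompactIn U) : Sing k U →₀ R :=
  ((p.restrict U).exists_finite_chain ξ.2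
    (isCompact_preimage K)).choose

lemma Perversity.finitePart_mem {U : Set X} {k : ℕ} (ξ : (p.restrict U).lfInterChains R k)
    (K : CompactIn U) : p.finitePart ξ K ∈ (p.restrict U).chains R k :=
  ((p.restrict U).exists_finite_chain ξ.2 (isCompact_preimage K)).choose_spec.1

lemma Perversity.finitePart_apply {U : Set X} {k : ℕ} (ξ : (p.restrict U).lfInterChains R k)
    (K : CompactIn U) (σ : Sing k U) (h : ∃ t, (σ t : X) ∈ K.1) :
    p.finitePart ξ K σ = ξ.1.1 σ :=
  ((p.restrict U).exists_finite_chain ξ.2 (isCompact_preimage K)).choose_spec.2 σ h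

/-- The inclusion of finite `p`-intersection chains of a subspace. -/
def Perversity.pushInter {U : Set X} {k : ℕ} (c : (p.restrict U).Chains R k) : p.Chains R k :=
  ⟨pushChain R U k c.1, (p.pushChain_mem c.1).2 c.2⟩

/-- The component at `K` of the natural restriction: the class in `C(X, X \ K)` of a finite part
of `ξ` near `K`. -/
def Perversity.restrictAt {U : Set X} {k : ℕ} (ξ : (p.restrict U).lfInterChains R k)
    (K : CompactIn U) : p.RelChains R K.1ᶜ k :=
  Submodule.Quotient.mk (p.pushInter ⟨p.finitePart ξ K, p.finitePart_mem ξ K⟩)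

/-- The component at `K` of the natural restriction is the class of any finite `p`-intersection
chain of `U` with the same coefficients on all simplices that meet `K`. -/
lemma Perversity.restrictAt_eq {U : Set X} {k : ℕ} (ξ : (p.restrict U).lfInterChains R k)
    (K : CompactIn U) (c : (p.restrict U).Chains R k)
    (hc : ∀ σ : Sing k U, (∃ t, (σ t : X) ∈ K.1) → c.1 σ = ξ.1.1 σ) :
    p.restrictAt ξ K = Submodule.Quotient.mk (p.pushInter c) := by
  rw [Perversity.restrictAt, Submodule.Quotient.eq, p.mem_subChains]
  intro σ hσ t ht
  apply hσ
  change pushChain R U k (p.finitePart ξ K) σ - pushChain R U k c.1 σ = 0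
  by_cases h : ∃ τ : Sing k U, τ.push = σ
  · obtain ⟨τ, rfl⟩ := h
    rw [pushChain_apply_push, pushChain_apply_push, hc τ ⟨t, ht⟩,
      p.finitePart_apply ξ K τ ⟨t, ht⟩, sub_self]
  · have h0 : ∀ c : Sing k U →₀ R, pushChain R U k c σ = 0 := fun c => by
      by_contra h'
      exact h (exists_of_pushChain_ne_zero h')
    rw [h0, h0, sub_self]

variable (R)

/-- The natural restriction in degree `k`. -/
def Perversity.naturalMap (U : Set X) (k : ℕ) :
    (p.restrict U).lfInterChains R k →ₗ[R] p.limChains R U k where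
  toFun ξ := ⟨fun K => p.restrictAt ξ K, fun K K' h => by
    symm
    refine p.restrictAt_eq ξ K ⟨p.finitePart ξ K', p.finitePart_mem ξ K'⟩ ?_
    rintro σ ⟨t, ht⟩
    exact p.finitePart_apply ξ K' σ ⟨t, h ht⟩⟩
  map_add' ξ η := Subtype.ext (funext fun K => by
    have h := p.restrictAt_eq (ξ + η) K
      (⟨p.finitePart ξ K, p.finitePart_mem ξ K⟩ + ⟨p.finitePart η K, p.finitePart_mem η K⟩)
      (fun σ hσ => by
        change p.finitePart ξ K σ + p.finitePart η K σ = ξ.1.1 σ + η.1.1 σ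
        rw [p.finitePart_apply ξ K σ hσ, p.finitePart_apply η K σ hσ])
    refine h.trans ?_
    change _ = p.restrictAt ξ K + p.restrictAt η K
    rw [Perversity.restrictAt, Perversity.restrictAt, ← Submodule.Quotient.mk_add]
    exact congrArg _ (Subtype.ext (map_add (pushChain R U k) _ _)))
  map_smul' r ξ := Subtype.ext (funext fun K => by
    have h := p.restrictAt_eq (r • ξ) K (r • ⟨p.finitePart ξ K, p.finitePart_mem ξ K⟩)
      (fun σ hσ => by
        change r • p.finitePart ξ K σ = r • ξ.1.1 σ
        rw [p.finitePart_apply ξ K σ hσ])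
    refine h.trans ?_
    change _ = r • p.restrictAt ξ K
    rw [Perversity.restrictAt, ← Submodule.Quotient.mk_smul]
    exact congrArg _ (Subtype.ext (map_smul (pushChain R U k) _ _)))

lemma Perversity.limD_naturalMap (U : Set X) (k : ℕ) :
    p.limD R U k ∘ₗ p.naturalMap R U (k + 1) = p.naturalMap R U k ∘ₗ (p.restrict U).lfD R k := by
  refine LinearMap.ext fun ξ => Subtype.ext (funext fun K => ?_)
  symm
  refine (p.restrictAt_eq ((p.restrict U).lfD R k ξ) K
    ((p.restrict U).d R k ⟨p.finitePart ξ K, p.finitePart_mem ξ K⟩) ?_).trans ?_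
  · rintro τ ⟨t, ht⟩
    change (F.restrict U).finBd R k (p.finitePart ξ K) τ = (F.restrict U).lfBd R ξ.1.1 τ
    symm
    refine (F.restrict U).lfBd_eq_finBd ?_
    rintro i σ rfl
    exact p.finitePart_apply ξ K σ ⟨_, ht⟩
  · change _ = Submodule.Quotient.mk (p.d R k (p.pushInter _))
    exact congrArg _ (Subtype.ext (finBd_pushChain F _).symm)

/-- The natural restriction, from the complex of locally finite `p`-intersection chains of `U` to
`lim_{K ⊆ U} C(X, X \ K)`. -/
def Perversity.naturalRestriction (U : Set X) :
    (p.restrict U).lfComplex R ⟶ p.limComplex R U :=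
  ChainComplex.ofHom (X := (p.restrict U).lfComplex R) (Y := p.limComplex R U)
    (fun k => ModuleCat.ofHom (p.naturalMap R U k)) fun k => by
      simp only [Perversity.lfComplex, Perversity.limComplex, ChainComplex.of_d]
      rw [← ModuleCat.ofHom_comp, ← ModuleCat.ofHom_comp, p.limD_naturalMap R]

end Chains

end

end BMIntersection

/-! The restriction is injective: the coefficient of a simplex σ of `U` is visible in the component
at the compact set σ(Δ). It therefore suffices that the cokernel is acyclic: every γ in the limit
whose differential comes from a locally finite chain of `U` is the image of such a chain β plus a
boundary ∂ε (`Perversity.exists_eq_naturalMap_add_limD`).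

At a single compact `K ⊆ U` this is excision: C(X) modulo C(U) + C(X \ K) is acyclic
(`Perversity.excision`). Iterated barycentric subdivision is homotopic to the identity and makes
simplices small, but a small chain must still be split without violating the condition on
differentials. Splitting by the position of the first vertex achieves this: a regular non-allowable
face of an allowable simplex keeps the first vertex, so simplices whose bad faces cancel share their
first vertex and stay together (`Perversity.filter_mem_chains`). Subdivision preserves allowability
because the new vertices are ordered by increasing dimension of the faces they come from: the
vertices in a front face then form an initial segment, and there are no more of them than before
(`linSd_face`).

For the limit, take an exhaustion E₀ ⊆ E₁ ⊆ ⋯ of `U` by compact sets and representatives cⱼ of γ at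
Eⱼ. Excision gives eⱼ with cⱼ - ∂eⱼ in C(U) + C(X \ Eⱼ), and these have to be made compatible. If s
is any solution for Eⱼ₊₁, then ∂(s - eⱼ) lies in C(U) + C(X \ Eⱼ), so excision one degree higher
yields s - eⱼ = ∂f + u + w with u in `U` and w outside Eⱼ. Now s - ∂f - u is again a solution for
Eⱼ₊₁, and it differs from eⱼ by w only (`Perversity.excision_step`). The eⱼ define ε, and γ - ∂ε is
represented over every compact set by a finite chain of `U`; such chains glue to a locally finite β
(`Perversity.mem_range_naturalMap`). -/

namespace BMIntersection

universe u v

noncomputable section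

open scoped Classical

/-! ### Formal simplices on a vertex set: cones, barycentric subdivision and its homotopy -/

section LinearChains

variable (R : Type v) [CommRing R] {P Q : Type*}

/-- The boundary of a formal simplex, given by the list of its `m + 1` vertices. The complex is
augmented: in degree zero there is the empty list. -/
def linBd (m : ℕ) : ((Fin (m + 1) → P) →₀ R) →ₗ[R] ((Fin m → P) →₀ R) :=
  Finsupp.linearCombination R fun w => ∑ i : Fin (m + 1),
    Finsupp.single (w ∘ i.succAbove) ((-1 : R) ^ (i : ℕ))

lemma linBd_single (m : ℕ) (w : Fin (m + 1) → P) :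
    linBd R m (Finsupp.single w 1) = ∑ i : Fin (m + 1),
      Finsupp.single (w ∘ i.succAbove) ((-1 : R) ^ (i : ℕ)) := by
  rw [linBd, Finsupp.linearCombination_single, one_smul]

lemma linBd_linBd (m : ℕ) (c : (Fin (m + 2) → P) →₀ R) : linBd R m (linBd R (m + 1) c) = 0 := by
  suffices h : linBd R m ∘ₗ linBd R (m + 1) = (0 : ((Fin (m + 2) → P) →₀ R) →ₗ[R] _) from
    LinearMap.congr_fun h c
  refine Finsupp.lhom_ext' fun w => LinearMap.ext_ring ?_
  simp only [LinearMap.comp_apply, Finsupp.lsingle_apply, LinearMap.zero_apply]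
  have h1 : linBd R m (linBd R (m + 1) (Finsupp.single w 1)) = ∑ ij : Fin (m + 2) × Fin (m + 1),
      Finsupp.single ((w ∘ ij.1.succAbove) ∘ ij.2.succAbove) ((-1 : R) ^ (ij.1 + ij.2 : ℕ)) := by
    rw [Fintype.sum_prod_type, linBd_single, map_sum]
    refine Finset.sum_congr rfl fun i _ => ?_
    rw [linBd, Finsupp.linearCombination_single, Finset.smul_sum]
    refine Finset.sum_congr rfl fun j _ => ?_
    rw [Finsupp.smul_single, smul_eq_mul, pow_add]
  rw [h1]
  -- Each codimension-two face arises from two orders of deleting its vertices, with opposite signs;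
  -- the involution exchanges the two orders.
  refine Finset.sum_involution (fun ij _ => (ij.1.succAbove ij.2, ij.2.predAbove ij.1))
    ?_ ?_ ?_ ?_
  · rintro ⟨i, j⟩ -
    have : (w ∘ (i.succAbove j).succAbove) ∘ (j.predAbove i).succAbove =
        (w ∘ i.succAbove) ∘ j.succAbove := by
      ext k
      simp [Fin.succAbove_succAbove_succAbove_predAbove]
    rw [this, ← Finsupp.single_add, Fin.neg_one_pow_succAbove_add_predAbove, add_neg_cancel,
      Finsupp.single_zero]
  · rintro ⟨i, j⟩ - -
    simp [Fin.succAbove_ne]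
  · intros
    exact Finset.mem_univ _
  · rintro ⟨i, j⟩ -
    simp [Fin.succAbove_succAbove_predAbove, Fin.predAbove_predAbove_succAbove]

/-- The cone on a formal chain, with the apex as the last vertex. -/
def linCone (m : ℕ) (b : P) : ((Fin m → P) →₀ R) →ₗ[R] ((Fin (m + 1) → P) →₀ R) :=
  Finsupp.lmapDomain R R fun w => Fin.snoc (α := fun _ => P) w b

lemma linCone_single (m : ℕ) (b : P) (w : Fin m → P) (r : R) :
    linCone R m b (Finsupp.single w r) = Finsupp.single (Fin.snoc (α := fun _ => P) w b) r := by
  rw [linCone, Finsupp.lmapDomain_apply, Finsupp.mapDomain_single]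

lemma snoc_comp_castSucc_succAbove {m : ℕ} (w : Fin (m + 1) → P) (b : P) (i : Fin (m + 1)) :
    (Fin.snoc (α := fun _ => P) w b : Fin (m + 2) → P) ∘ i.castSucc.succAbove =
      Fin.snoc (α := fun _ => P) (w ∘ i.succAbove) b := by
  ext j
  refine Fin.lastCases ?_ (fun j => ?_) j
  · rw [Function.comp_apply, Fin.succAbove_ne_last_last (Fin.castSucc_ne_last i)]
    simp
  · rw [Function.comp_apply, Fin.castSucc_succAbove_castSucc]
    simp

/-- Omitting a vertex other than the apex commutes with coning. The apex has the last index, which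
is where the sign in front of `c` comes from; `linSd` and `linHtpy` carry signs that cancel it. -/
lemma linBd_linCone (m : ℕ) (b : P) (c : (Fin (m + 1) → P) →₀ R) :
    linBd R (m + 1) (linCone R (m + 1) b c) =
      linCone R m b (linBd R m c) + (-1 : R) ^ (m + 1) • c := by
  suffices h : linBd R (m + 1) ∘ₗ linCone R (m + 1) b =
      linCone R m b ∘ₗ linBd R m + (-1 : R) ^ (m + 1) • LinearMap.id from LinearMap.congr_fun h c
  refine Finsupp.lhom_ext' fun w => LinearMap.ext_ring ?_
  simp only [LinearMap.comp_apply, Finsupp.lsingle_apply, LinearMap.add_apply,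
    LinearMap.smul_apply, LinearMap.id_apply, linCone_single, linBd_single]
  rw [Fin.sum_univ_castSucc, map_sum]
  congr 1
  · refine Finset.sum_congr rfl fun i _ => ?_
    rw [linCone_single, snoc_comp_castSucc_succAbove]
    rfl
  · rw [Finsupp.smul_single, smul_eq_mul, mul_one]
    congr 1
    ext j
    simp

lemma linBd_linCone_zero (b : P) (c : (Fin 0 → P) →₀ R) :
    linBd R 0 (linCone R 0 b c) = c := by
  suffices h : linBd R 0 ∘ₗ linCone R 0 b = LinearMap.id from LinearMap.congr_fun h c
  refine Finsupp.lhom_ext' fun w => LinearMap.ext_ring ?_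
  simp only [LinearMap.comp_apply, Finsupp.lsingle_apply, LinearMap.id_apply, linCone_single,
    linBd_single]
  rw [Fin.sum_univ_one, Fin.val_zero, pow_zero]
  exact congrArg (fun v => Finsupp.single v 1) (Subsingleton.elim _ _)

variable (b : ∀ m, (Fin (m + 1) → P) → P)

/-- The barycentric subdivision of formal chains; `b` gives the barycentres. The new vertices are
ordered by increasing dimension of the faces of which they are the barycentres. -/
def linSd : ∀ m : ℕ, ((Fin m → P) →₀ R) →ₗ[R] ((Fin m → P) →₀ R)
  | 0 => LinearMap.id
  | m + 1 => Finsupp.linearCombination R fun w =>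
      (-1 : R) ^ m • linCone R m (b m w) (linSd m (linBd R m (Finsupp.single w 1)))

/-- The homotopy between the identity and the barycentric subdivision. -/
def linHtpy : ∀ m : ℕ, ((Fin m → P) →₀ R) →ₗ[R] ((Fin (m + 1) → P) →₀ R)
  | 0 => 0
  | m + 1 => Finsupp.linearCombination R fun w =>
      (-1 : R) ^ (m + 1) • linCone R (m + 1) (b m w)
        (Finsupp.single w 1 - linHtpy m (linBd R m (Finsupp.single w 1)))

lemma linSd_succ_single (m : ℕ) (w : Fin (m + 1) → P) :
    linSd R b (m + 1) (Finsupp.single w 1) =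
      (-1 : R) ^ m • linCone R m (b m w) (linSd R b m (linBd R m (Finsupp.single w 1))) := by
  rw [linSd, Finsupp.linearCombination_single, one_smul]

lemma linHtpy_succ_single (m : ℕ) (w : Fin (m + 1) → P) :
    linHtpy R b (m + 1) (Finsupp.single w 1) =
      (-1 : R) ^ (m + 1) • linCone R (m + 1) (b m w)
        (Finsupp.single w 1 - linHtpy R b m (linBd R m (Finsupp.single w 1))) := by
  rw [linHtpy, Finsupp.linearCombination_single, one_smul]

lemma neg_one_pow_smul_neg_one_pow_smul {M : Type*} [AddCommGroup M] [Module R M] (m : ℕ) (x : M) :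
    (-1 : R) ^ m • (-1 : R) ^ m • x = x := by
  rw [smul_smul, ← mul_pow, neg_one_mul, neg_neg, one_pow, one_smul]

/-- The subdivision of a simplex is a cone on the subdivided boundary, which is a cycle by induction
and ∂∂ = 0. So only the base of the cone survives in the differential. -/
lemma linBd_linSd (m : ℕ) (c : (Fin (m + 1) → P) →₀ R) :
    linBd R m (linSd R b (m + 1) c) = linSd R b m (linBd R m c) := by
  suffices h : linBd R m ∘ₗ linSd R b (m + 1) = linSd R b m ∘ₗ linBd R m from
    LinearMap.congr_fun h c
  induction m with
  | zero =>
    refine Finsupp.lhom_ext' fun w => LinearMap.ext_ring ?_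
    simp only [LinearMap.comp_apply, Finsupp.lsingle_apply]
    rw [linSd_succ_single, map_smul, linBd_linCone_zero, pow_zero, one_smul]
  | succ m ih =>
    refine Finsupp.lhom_ext' fun w => LinearMap.ext_ring ?_
    simp only [LinearMap.comp_apply, Finsupp.lsingle_apply]
    have h : linBd R m (linSd R b (m + 1) (linBd R (m + 1) (Finsupp.single w 1))) = 0 := by
      have := LinearMap.congr_fun (ih 0) (linBd R (m + 1) (Finsupp.single w 1))
      simp only [LinearMap.comp_apply] at this
      rw [this, linBd_linBd, map_zero]
    rw [linSd_succ_single, map_smul, linBd_linCone, h, map_zero, zero_add,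
      neg_one_pow_smul_neg_one_pow_smul]

/-- The homotopy T cones w - T∂w from the barycentre. The base contributes w - T∂w to the
differential; by induction ∂(w - T∂w) is the subdivision of ∂w, so the cone on it contributes the
subdivision of w. -/
lemma linBd_linHtpy (m : ℕ) (c : (Fin (m + 1) → P) →₀ R) :
    linBd R (m + 1) (linHtpy R b (m + 1) c) + linHtpy R b m (linBd R m c) =
      c - linSd R b (m + 1) c := by
  suffices h : linBd R (m + 1) ∘ₗ linHtpy R b (m + 1) + linHtpy R b m ∘ₗ linBd R m =
      LinearMap.id - linSd R b (m + 1) from LinearMap.congr_fun h c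
  induction m with
  | zero =>
    refine Finsupp.lhom_ext' fun w => LinearMap.ext_ring ?_
    simp only [LinearMap.comp_apply, Finsupp.lsingle_apply, LinearMap.add_apply,
      LinearMap.sub_apply, LinearMap.id_apply]
    rw [linHtpy_succ_single, linSd_succ_single]
    simp only [linHtpy, LinearMap.zero_apply, sub_zero, map_smul, add_zero, linSd,
      LinearMap.id_apply, linBd_linCone, smul_add, neg_one_pow_smul_neg_one_pow_smul]
    simp
    abel
  | succ m ih =>
    refine Finsupp.lhom_ext' fun w => LinearMap.ext_ring ?_
    simp only [LinearMap.comp_apply, Finsupp.lsingle_apply, LinearMap.add_apply,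
      LinearMap.sub_apply, LinearMap.id_apply]
    have h : linBd R (m + 1) (linHtpy R b (m + 1) (linBd R (m + 1) (Finsupp.single w 1))) =
        linBd R (m + 1) (Finsupp.single w 1) -
          linSd R b (m + 1) (linBd R (m + 1) (Finsupp.single w 1)) := by
      have := LinearMap.congr_fun (ih 0) (linBd R (m + 1) (Finsupp.single w 1))
      simp only [LinearMap.comp_apply, LinearMap.add_apply, LinearMap.sub_apply,
        LinearMap.id_apply, linBd_linBd, map_zero, add_zero] at this
      exact this
    rw [linHtpy_succ_single, linSd_succ_single, map_smul, linBd_linCone, smul_add,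
      neg_one_pow_smul_neg_one_pow_smul, map_sub, h, sub_sub_cancel, pow_succ]
    simp only [mul_neg, mul_one, neg_smul]
    rw [pow_succ]
    simp only [mul_neg, mul_one, neg_smul]
    abel

/-! ### Naturality -/

variable {b} {b' : ∀ m, (Fin (m + 1) → Q) → Q} {f : P → Q}

/-- The map of formal chains induced by a map of vertices. -/
def linMap (f : P → Q) (m : ℕ) : ((Fin m → P) →₀ R) →ₗ[R] ((Fin m → Q) →₀ R) :=
  Finsupp.lmapDomain R R fun w => f ∘ w

lemma linMap_single (m : ℕ) (w : Fin m → P) (r : R) :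
    linMap R f m (Finsupp.single w r) = Finsupp.single (f ∘ w) r := by
  rw [linMap, Finsupp.lmapDomain_apply, Finsupp.mapDomain_single]

lemma linBd_linMap (m : ℕ) (c : (Fin (m + 1) → P) →₀ R) :
    linBd R m (linMap R f (m + 1) c) = linMap R f m (linBd R m c) := by
  suffices h : linBd R m ∘ₗ linMap R f (m + 1) = linMap R f m ∘ₗ linBd R m from
    LinearMap.congr_fun h c
  refine Finsupp.lhom_ext' fun w => LinearMap.ext_ring ?_
  simp only [LinearMap.comp_apply, Finsupp.lsingle_apply, linMap_single, linBd_single, map_sum]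
  rfl

lemma linCone_linMap (m : ℕ) (a : P) (c : (Fin m → P) →₀ R) :
    linCone R m (f a) (linMap R f m c) = linMap R f (m + 1) (linCone R m a c) := by
  suffices h : linCone R m (f a) ∘ₗ linMap R f m = linMap R f (m + 1) ∘ₗ linCone R m a from
    LinearMap.congr_fun h c
  refine Finsupp.lhom_ext' fun w => LinearMap.ext_ring ?_
  simp only [LinearMap.comp_apply, Finsupp.lsingle_apply, linMap_single, linCone_single]
  rw [Fin.comp_snoc]

lemma linSd_linMap (hf : ∀ m w, f (b m w) = b' m (f ∘ w)) (m : ℕ) (c : (Fin m → P) →₀ R) :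
    linSd R b' m (linMap R f m c) = linMap R f m (linSd R b m c) := by
  suffices h : linSd R b' m ∘ₗ linMap R f m = linMap R f m ∘ₗ linSd R b m from
    LinearMap.congr_fun h c
  induction m with
  | zero => rfl
  | succ m ih =>
    refine Finsupp.lhom_ext' fun w => LinearMap.ext_ring ?_
    simp only [LinearMap.comp_apply, Finsupp.lsingle_apply, linMap_single, linSd_succ_single,
      map_smul]
    rw [← hf, ← linMap_single, linBd_linMap, ← linCone_linMap]
    exact congrArg _ (congrArg _ (LinearMap.congr_fun (ih 0) _))

lemma linHtpy_linMap (hf : ∀ m w, f (b m w) = b' m (f ∘ w)) (m : ℕ) (c : (Fin m → P) →₀ R) :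
    linHtpy R b' m (linMap R f m c) = linMap R f (m + 1) (linHtpy R b m c) := by
  suffices h : linHtpy R b' m ∘ₗ linMap R f m = linMap R f (m + 1) ∘ₗ linHtpy R b m from
    LinearMap.congr_fun h c
  induction m with
  | zero => simp [linHtpy]
  | succ m ih =>
    refine Finsupp.lhom_ext' fun w => LinearMap.ext_ring ?_
    simp only [LinearMap.comp_apply, Finsupp.lsingle_apply, linMap_single, linHtpy_succ_single,
      map_smul]
    rw [← hf, ← linMap_single, linBd_linMap, ← linCone_linMap, map_sub (linMap R f (m + 1))]
    have := LinearMap.congr_fun (ih 0) (linBd R m (Finsupp.single w 1))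
    simp only [LinearMap.comp_apply] at this
    rw [this]

end LinearChains

/-! ### Which simplices occur in a subdivision, and how they meet the front faces -/

section LinearSupport

variable {R : Type v} [CommRing R] {P : Type*}

/-- Linearity reduces support questions to single simplices; the support arguments for cones,
subdivisions and realizations rest on this. -/
lemma exists_single_of_map_ne_zero {α β : Type*} (L : (α →₀ R) →ₗ[R] (β →₀ R)) {c : α →₀ R} {y : β}
    (h : L c y ≠ 0) : ∃ x, c x ≠ 0 ∧ L (Finsupp.single x 1) y ≠ 0 := by
  by_contra! H
  apply h
  have : L c = c.sum fun x r => r • L (Finsupp.single x 1) := by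
    conv_lhs => rw [← Finsupp.sum_single c, Finsupp.sum, map_sum]
    refine Finset.sum_congr rfl fun x _ => ?_
    change L (Finsupp.single x (c x)) = c x • L (Finsupp.single x 1)
    rw [← map_smul, Finsupp.smul_single, smul_eq_mul, mul_one]
  rw [this, Finsupp.sum_apply]
  refine Finset.sum_eq_zero fun x hx => ?_
  change c x • L (Finsupp.single x 1) y = 0
  rw [H x (by simpa using hx), smul_zero]

lemma exists_face_of_linBd_ne_zero {m : ℕ} {w : Fin (m + 1) → P} {v : Fin m → P}
    (h : linBd R m (Finsupp.single w 1) v ≠ 0) : ∃ i : Fin (m + 1), w ∘ i.succAbove = v := by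
  by_contra! H
  apply h
  rw [linBd_single, Finsupp.finsetSum_apply]
  exact Finset.sum_eq_zero fun i _ => Finsupp.single_eq_of_ne (H i).symm

lemma exists_of_linCone_ne_zero {m : ℕ} {a : P} {c : (Fin m → P) →₀ R} {w : Fin (m + 1) → P}
    (h : linCone R m a c w ≠ 0) : ∃ v, c v ≠ 0 ∧ w = Fin.snoc (α := fun _ => P) v a := by
  obtain ⟨v, hv, hv'⟩ := exists_single_of_map_ne_zero _ h
  refine ⟨v, hv, ?_⟩
  rw [linCone_single] at hv'
  by_contra H
  exact hv' (Finsupp.single_eq_of_ne H)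

variable {b : ∀ m, (Fin (m + 1) → P) → P}

lemma linSd_support {m : ℕ} {w w' : Fin (m + 1) → P}
    (h : linSd R b (m + 1) (Finsupp.single w 1) w' ≠ 0) :
    ∃ (i : Fin (m + 1)) (v : Fin m → P), linSd R b m (Finsupp.single (w ∘ i.succAbove) 1) v ≠ 0 ∧
      w' = Fin.snoc (α := fun _ => P) v (b m w) := by
  rw [linSd_succ_single, Finsupp.smul_apply, smul_eq_mul] at h
  obtain ⟨v, hv, rfl⟩ := exists_of_linCone_ne_zero (right_ne_zero_of_mul h)
  obtain ⟨x, hx, hx'⟩ := exists_single_of_map_ne_zero _ hv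
  obtain ⟨i, rfl⟩ := exists_face_of_linBd_ne_zero hx
  exact ⟨i, v, hx', rfl⟩

lemma linHtpy_support {m : ℕ} {w : Fin (m + 1) → P} {w' : Fin (m + 2) → P}
    (h : linHtpy R b (m + 1) (Finsupp.single w 1) w' ≠ 0) :
    ∃ v : Fin (m + 1) → P, (v = w ∨ ∃ i : Fin (m + 1),
      linHtpy R b m (Finsupp.single (w ∘ i.succAbove) 1) v ≠ 0) ∧
      w' = Fin.snoc (α := fun _ => P) v (b m w) := by
  rw [linHtpy_succ_single, Finsupp.smul_apply, smul_eq_mul] at h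
  obtain ⟨v, hv, rfl⟩ := exists_of_linCone_ne_zero (right_ne_zero_of_mul h)
  refine ⟨v, ?_, rfl⟩
  by_cases hvw : v = w
  · exact Or.inl hvw
  right
  rw [Finsupp.sub_apply, Finsupp.single_eq_of_ne hvw, zero_sub, neg_ne_zero] at hv
  obtain ⟨x, hx, hx'⟩ := exists_single_of_map_ne_zero _ hv
  obtain ⟨i, rfl⟩ := exists_face_of_linBd_ne_zero hx
  exact ⟨i, hx'⟩

lemma forall_snoc {m : ℕ} {C : P → Prop} {v : Fin m → P} {a : P} :
    (∀ j, C ((Fin.snoc (α := fun _ => P) v a : Fin (m + 1) → P) j)) ↔ (∀ j, C (v j)) ∧ C a := by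
  rw [Fin.forall_fin_succ']
  simp

/-- Sets that are closed under barycentres contain the subdivisions of their simplices. -/
lemma linSd_mem_of_closed {C : P → Prop} (hC : ∀ m w, (∀ j, C (w j)) → C (b m w)) {m : ℕ}
    {w w' : Fin m → P} (h : linSd R b m (Finsupp.single w 1) w' ≠ 0) (hw : ∀ j, C (w j)) :
    ∀ j, C (w' j) := by
  induction m with
  | zero => exact fun j => j.elim0
  | succ m ih =>
    obtain ⟨i, v, hv, rfl⟩ := linSd_support h
    exact forall_snoc.2 ⟨ih hv fun j => hw _, hC m w hw⟩

lemma linHtpy_mem_of_closed {C : P → Prop} (hC : ∀ m w, (∀ j, C (w j)) → C (b m w)) {m : ℕ}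
    {w : Fin m → P} {w' : Fin (m + 1) → P} (h : linHtpy R b m (Finsupp.single w 1) w' ≠ 0)
    (hw : ∀ j, C (w j)) : ∀ j, C (w' j) := by
  induction m with
  | zero => simp [linHtpy] at h
  | succ m ih =>
    obtain ⟨v, hv, rfl⟩ := linHtpy_support h
    refine forall_snoc.2 ⟨?_, hC m w hw⟩
    rcases hv with rfl | ⟨i, hi⟩
    · exact hw
    · exact ih hi fun j => hw _

/-! ### Compatibility with faces -/

/-- The vertices of the list `w` in `G` form an initial segment. -/
def IsInitial (G : P → Prop) {m : ℕ} (w : Fin m → P) : Prop :=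
  ∀ j l, j ≤ l → G (w l) → G (w j)

lemma IsInitial.comp_succAbove {G : P → Prop} {m : ℕ} {w : Fin (m + 1) → P} (h : IsInitial G w)
    (i : Fin (m + 1)) : IsInitial G (w ∘ i.succAbove) :=
  fun _ _ hjl hl => h _ _ ((Fin.strictMono_succAbove i).monotone hjl) hl

lemma IsInitial.snoc {G : P → Prop} {m : ℕ} {v : Fin m → P} {a : P} (h : IsInitial G v)
    (ha : G a → ∀ j, G (v j)) : IsInitial G (Fin.snoc (α := fun _ => P) v a : Fin (m + 1) → P) := by
  intro j l
  refine Fin.lastCases ?_ (fun l => ?_) l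
  · rw [Fin.snoc_last]
    exact fun _ hl => forall_snoc.2 ⟨ha hl, hl⟩ j
  · refine Fin.lastCases ?_ (fun j => ?_) j
    · intro hlt
      exact absurd hlt (not_le.2 (Fin.castSucc_lt_last l))
    · simp only [Fin.snoc_castSucc, Fin.castSucc_le_castSucc_iff]
      exact h j l

/-- The number of vertices of the list `w` in `G`. -/
def countIn (G : P → Prop) {m : ℕ} (w : Fin m → P) : ℕ :=
  (Finset.univ.filter fun j => G (w j)).card

lemma countIn_le (G : P → Prop) {m : ℕ} (w : Fin m → P) : countIn G w ≤ m :=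
  (Finset.card_le_univ _).trans_eq (Fintype.card_fin m)

lemma countIn_eq {G : P → Prop} {m : ℕ} {w : Fin m → P} (h : ∀ j, G (w j)) : countIn G w = m := by
  simp [countIn, h]

lemma countIn_comp_succAbove_le (G : P → Prop) {m : ℕ} (w : Fin (m + 1) → P) (i : Fin (m + 1)) :
    countIn G (w ∘ i.succAbove) ≤ countIn G w :=
  Finset.card_le_card_of_injOn i.succAbove (fun j hj => by simpa using hj)
    Fin.succAbove_right_injective.injOn

lemma countIn_snoc_le {G : P → Prop} {m : ℕ} {v : Fin m → P} {a : P} (ha : ¬ G a) :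
    countIn G (Fin.snoc (α := fun _ => P) v a : Fin (m + 1) → P) ≤ countIn G v := by
  rw [countIn, countIn, Finset.card_filter, Finset.card_filter, Fin.sum_univ_castSucc]
  simp [ha]

variable {G : P → Prop} (hG : ∀ m w, G (b m w) ↔ ∀ j, G (w j))

include hG

/-- With `G` a front face, the three conclusions serve, in order, for the block structure of a
regular simplex, for the bound on perverse degrees, and for meeting the regular part. The last
vertex of `w'` is the barycentre of `w`. If it lies in `G`, so does all of `w`, and the count is
already maximal; otherwise it adds nothing to the count of a simplex in a subdivided facet. -/
lemma linSd_face {m : ℕ} {w w' : Fin m → P} (h : linSd R b m (Finsupp.single w 1) w' ≠ 0)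
    (hw : IsInitial G w) :
    IsInitial G w' ∧ countIn G w' ≤ countIn G w ∧ ((∀ j, G (w' j)) → ∀ j, G (w j)) := by
  induction m with
  | zero => exact ⟨fun j => j.elim0, by simp [countIn], fun _ j => j.elim0⟩
  | succ m ih =>
    obtain ⟨i, v, hv, rfl⟩ := linSd_support h
    obtain ⟨h1, h2, h3⟩ := ih hv (hw.comp_succAbove i)
    refine ⟨h1.snoc fun ha => ?_, ?_, fun h' => (hG m w).1 (forall_snoc.1 h').2⟩
    · exact linSd_mem_of_closed (fun m w => (hG m w).2) hv fun j => (hG m w).1 ha _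
    · by_cases ha : G (b m w)
      · rw [countIn_eq ((hG m w).1 ha)]
        exact countIn_le _ _
      · exact (countIn_snoc_le ha).trans (h2.trans (countIn_comp_succAbove_le G w i))

/-- One more vertex in `G` is admissible, because the simplices of the homotopy have one dimension
more. -/
lemma linHtpy_face {m : ℕ} {w : Fin m → P} {w' : Fin (m + 1) → P}
    (h : linHtpy R b m (Finsupp.single w 1) w' ≠ 0) (hw : IsInitial G w) :
    IsInitial G w' ∧ countIn G w' ≤ countIn G w + 1 ∧ ((∀ j, G (w' j)) → ∀ j, G (w j)) := by
  induction m with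
  | zero => simp [linHtpy] at h
  | succ m ih =>
    have hmem := fun ha => linHtpy_mem_of_closed (fun m w => (hG m w).2) h ((hG m w).1 ha)
    obtain ⟨v, hv, rfl⟩ := linHtpy_support h
    have h12 : IsInitial G v ∧ countIn G v ≤ countIn G w + 1 := by
      rcases hv with rfl | ⟨i, hi⟩
      · exact ⟨hw, Nat.le_succ _⟩
      · obtain ⟨h1, h2, -⟩ := ih hi (hw.comp_succAbove i)
        exact ⟨h1, h2.trans (Nat.succ_le_succ (countIn_comp_succAbove_le G w i))⟩
    refine ⟨h12.1.snoc fun ha => (forall_snoc.1 (hmem ha)).1, ?_,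
      fun h' => (hG m w).1 (forall_snoc.1 h').2⟩
    by_cases ha : G (b m w)
    · rw [countIn_eq ((hG m w).1 ha)]
      exact countIn_le _ _
    · exact (countIn_snoc_le ha).trans h12.2

end LinearSupport

/-! ### Subdivision shrinks the mesh -/

section Mesh

variable {R : Type v} [CommRing R] {P : Type*} [PseudoMetricSpace P]
  {b : ∀ m, (Fin (m + 1) → P) → P}
  (hball : ∀ m w x r, (∀ j, dist (w j) x ≤ r) → dist (b m w) x ≤ r)
  (hb : ∀ m w D, (∀ i j, dist (w i) (w j) ≤ D) → ∀ j, dist (w j) (b m w) ≤ m / (m + 1) * D)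

include hball hb

lemma linSd_mesh {m : ℕ} {w w' : Fin (m + 1) → P} {D : ℝ}
    (h : linSd R b (m + 1) (Finsupp.single w 1) w' ≠ 0) (hw : ∀ i j, dist (w i) (w j) ≤ D) :
    ∀ i j, dist (w' i) (w' j) ≤ m / (m + 1) * D := by
  have hD : 0 ≤ D := dist_nonneg.trans (hw 0 0)
  induction m with
  | zero =>
    intro i j
    rw [show i = j from Subsingleton.elim (α := Fin 1) i j, dist_self]
    positivity
  | succ m ih =>
    obtain ⟨i, v, hv, rfl⟩ := linSd_support h
    have h1 := ih hv fun _ _ => hw _ _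
    -- The closed ball about the new barycentre contains the vertices of `w`. Being closed under
    -- barycentres, it also contains the vertices of the subdivided facet.
    have h2 : ∀ j, dist (v j) (b (m + 1) w) ≤ (m + 1 : ℕ) / ((m + 1 : ℕ) + 1) * D :=
      linSd_mem_of_closed (C := fun x => dist x (b (m + 1) w) ≤ (m + 1 : ℕ) / ((m + 1 : ℕ) + 1) * D)
        (fun m w hw => hball m w _ _ hw) hv fun j => hb _ w D hw _
    -- The factor increases with the dimension, so the bound for the facet is good enough.
    have h3 : (m : ℝ) / (m + 1) * D ≤ (m + 1 : ℕ) / ((m + 1 : ℕ) + 1) * D := by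
      refine mul_le_mul_of_nonneg_right ?_ hD
      push_cast
      rw [div_le_div_iff₀ (by positivity) (by positivity)]
      nlinarith
    refine (forall_snoc (C := fun x => ∀ j, dist x
      ((Fin.snoc (α := fun _ => P) v (b (m + 1) w) : Fin (m + 2) → P) j) ≤ _)).2 ⟨fun l => ?_, ?_⟩
    · exact (forall_snoc (C := fun y => dist (v l) y ≤ _)).2 ⟨fun j => (h1 l j).trans h3, h2 l⟩
    · refine (forall_snoc (C := fun y => dist (b (m + 1) w) y ≤ _)).2 ⟨fun j => ?_, ?_⟩
      · rw [dist_comm]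
        exact h2 j
      · rw [dist_self]
        positivity

lemma linSd_iterate_mesh {m : ℕ} {w w' : Fin (m + 1) → P} {D : ℝ} (r : ℕ)
    (h : (linSd R b (m + 1))^[r] (Finsupp.single w 1) w' ≠ 0)
    (hw : ∀ i j, dist (w i) (w j) ≤ D) :
    ∀ i j, dist (w' i) (w' j) ≤ (m / (m + 1)) ^ r * D := by
  induction r generalizing w' with
  | zero =>
    rw [Function.iterate_zero, id_eq] at h
    have : w' = w := by
      by_contra H
      exact h (Finsupp.single_eq_of_ne H)
    subst this
    simpa using hw
  | succ r ih =>
    rw [Function.iterate_succ_apply'] at h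
    obtain ⟨x, hx, hx'⟩ := exists_single_of_map_ne_zero _ h
    intro i j
    rw [pow_succ', mul_assoc]
    exact linSd_mesh hball hb hx' (ih hx) i j

end Mesh

/-! ### Affine simplices and barycentres in the standard simplex -/

section AffineSimplices

variable {ι : Type*} [Fintype ι]

/-- The affine simplex in a standard simplex with a given list of vertices. -/
def affineSimplex {m : ℕ} (w : Fin (m + 1) → stdSimplex ℝ ι) :
    C(stdSimplex ℝ (Fin (m + 1)), stdSimplex ℝ ι) where
  toFun t := ⟨∑ j, t j • (w j).1, (convex_stdSimplex ℝ ι).sum_mem (fun j _ => t.2.1 j) t.2.2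
    fun j _ => (w j).2⟩
  continuous_toFun := by
    have h (j : Fin (m + 1)) : Continuous fun t : stdSimplex ℝ (Fin (m + 1)) => t j :=
      (continuous_apply j).comp continuous_subtype_val
    exact Continuous.subtype_mk (continuous_finsetSum _ fun j _ => (h j).smul continuous_const) _

lemma affineSimplex_apply {m : ℕ} (w : Fin (m + 1) → stdSimplex ℝ ι) (t) (x : ι) :
    affineSimplex w t x = ∑ j, t j * w j x := by
  change (∑ j, t j • (w j).1) x = _
  rw [Finset.sum_apply]
  rfl

lemma affineSimplex_vertex {m : ℕ} (w : Fin (m + 1) → stdSimplex ℝ ι) (j : Fin (m + 1)) :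
    affineSimplex w (stdSimplex.vertex j) = w j := by
  ext x
  rw [affineSimplex_apply]
  simp [Pi.single_apply]

lemma affineSimplex_id {k : ℕ} :
    affineSimplex (stdSimplex.vertex : Fin (k + 1) → _) = ContinuousMap.id _ := by
  ext t x
  rw [affineSimplex_apply]
  simp [Pi.single_apply]

lemma affineSimplex_comp {m k : ℕ} (w : Fin (k + 1) → stdSimplex ℝ ι)
    (v : Fin (m + 1) → stdSimplex ℝ (Fin (k + 1))) :
    (affineSimplex w).comp (affineSimplex v) = affineSimplex (affineSimplex w ∘ v) := by
  ext t x
  rw [ContinuousMap.comp_apply, affineSimplex_apply, affineSimplex_apply]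
  simp only [affineSimplex_apply, Function.comp_apply, Finset.sum_mul, Finset.mul_sum]
  rw [Finset.sum_comm]
  simp only [mul_assoc]

lemma faceInclusion_eq_affineSimplex {k : ℕ} (i : Fin (k + 2)) :
    faceInclusion i = affineSimplex (stdSimplex.vertex ∘ i.succAbove) := by
  ext t x
  rw [affineSimplex_apply]
  change FunOnFinite.linearMap ℝ ℝ i.succAbove t x = _
  rw [FunOnFinite.linearMap_apply_apply, Finset.sum_filter]
  refine Finset.sum_congr rfl fun j _ => ?_
  simp [Pi.single_apply, eq_comm]

lemma affineSimplex_comp_faceInclusion {m : ℕ} (w : Fin (m + 2) → stdSimplex ℝ ι)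
    (i : Fin (m + 2)) :
    (affineSimplex w).comp (faceInclusion i) = affineSimplex (w ∘ i.succAbove) := by
  rw [faceInclusion_eq_affineSimplex, affineSimplex_comp]
  congr 1
  ext j : 1
  simp [affineSimplex_vertex]

/-- The barycentre of a list of points of a standard simplex. -/
def bary (m : ℕ) (w : Fin (m + 1) → stdSimplex ℝ ι) : stdSimplex ℝ ι :=
  affineSimplex w stdSimplex.barycenter

lemma affineSimplex_bary {k : ℕ} (w : Fin (k + 1) → stdSimplex ℝ ι) (m : ℕ)
    (v : Fin (m + 1) → stdSimplex ℝ (Fin (k + 1))) :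
    affineSimplex w (bary m v) = bary m (affineSimplex w ∘ v) := by
  rw [bary, bary, ← affineSimplex_comp]
  rfl

lemma bary_apply {m : ℕ} (w : Fin (m + 1) → stdSimplex ℝ ι) (x : ι) :
    bary m w x = ∑ j, ((m : ℝ) + 1)⁻¹ * w j x := by
  rw [bary, affineSimplex_apply]
  refine Finset.sum_congr rfl fun j _ => ?_
  change ((Fintype.card (Fin (m + 1)) : ℕ) : ℝ)⁻¹ * _ = _
  simp

lemma dist_affineSimplex_le {m : ℕ} {w : Fin (m + 1) → stdSimplex ℝ ι} {x : stdSimplex ℝ ι}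
    {r : ℝ} (h : ∀ j, dist (w j) x ≤ r) (t) : dist (affineSimplex w t) x ≤ r :=
  (convex_closedBall x.1 r).sum_mem (fun j _ => t.2.1 j) t.2.2 fun j _ => h j

lemma dist_bary_le {m : ℕ} {w : Fin (m + 1) → stdSimplex ℝ ι} {D : ℝ}
    (h : ∀ i j, dist (w i) (w j) ≤ D) (j : Fin (m + 1)) :
    dist (w j) (bary m w) ≤ m / (m + 1) * D := by
  have hD : 0 ≤ D := dist_nonneg.trans (h 0 0)
  rw [Subtype.dist_eq, dist_pi_le_iff (by positivity)]
  intro x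
  change dist (w j x) (bary m w x) ≤ _
  have h0 : w j x - bary m w x = ((m : ℝ) + 1)⁻¹ * ∑ l, (w j x - w l x) := by
    rw [bary_apply, Finset.sum_sub_distrib, mul_sub, Finset.mul_sum, Finset.mul_sum]
    simp only [Finset.sum_const, Finset.card_univ, Fintype.card_fin, nsmul_eq_mul]
    push_cast
    rw [mul_inv_cancel_left₀ (by positivity)]
  rw [Real.dist_eq, h0, abs_mul, abs_of_nonneg (by positivity : (0 : ℝ) ≤ ((m : ℝ) + 1)⁻¹),
    div_mul_eq_mul_div, div_eq_inv_mul]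
  refine mul_le_mul_of_nonneg_left ?_ (by positivity)
  -- The term `l = j` vanishes, which leaves m of the m + 1 differences and explains the factor m /
  -- (m + 1).
  rw [Fin.sum_univ_succAbove _ j, sub_self, zero_add]
  refine (Finset.abs_sum_le_sum_abs _ _).trans ?_
  refine (Finset.sum_le_sum (g := fun _ => D) fun l _ => ?_).trans_eq (by simp)
  have h1 := h j (j.succAbove l)
  rw [Subtype.dist_eq, dist_pi_le_iff hD] at h1
  exact h1 x

/-- The front face of the standard simplex spanned by the vertices of index less than `a`. -/
def Front {k : ℕ} (a : ℕ) (t : stdSimplex ℝ (Fin (k + 1))) : Prop :=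
  ∀ j : Fin (k + 1), a ≤ j → t j = 0

/-- A sum of non-negative terms vanishes only if every term does. -/
lemma front_affineSimplex {k m a : ℕ} {w : Fin (m + 1) → stdSimplex ℝ (Fin (k + 1))} {t} :
    Front a (affineSimplex w t) ↔ ∀ l, t l = 0 ∨ Front a (w l) := by
  have h : ∀ j, affineSimplex w t j = 0 ↔ ∀ l, t l = 0 ∨ w l j = 0 := by
    intro j
    rw [affineSimplex_apply, Finset.sum_eq_zero_iff_of_nonneg fun l _ =>
      mul_nonneg (stdSimplex.zero_le t l) (stdSimplex.zero_le (w l) j)]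
    simp
  simp only [Front, h]
  constructor
  · intro H l
    by_cases hl : t l = 0
    · exact Or.inl hl
    · exact Or.inr fun j hj => (H j hj l).resolve_left hl
  · exact fun H j hj l => (H l).imp_right fun h' => h' j hj

lemma barycenter_ne_zero {m : ℕ} (l : Fin (m + 1)) :
    (stdSimplex.barycenter : stdSimplex ℝ (Fin (m + 1))) l ≠ 0 := by
  change ((Fintype.card (Fin (m + 1)) : ℕ) : ℝ)⁻¹ ≠ 0
  simp
  positivity

lemma front_bary {k a : ℕ} (m : ℕ) (w : Fin (m + 1) → stdSimplex ℝ (Fin (k + 1))) :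
    Front a (bary m w) ↔ ∀ j, Front a (w j) := by
  rw [bary, front_affineSimplex]
  exact forall_congr' fun l => or_iff_right (barycenter_ne_zero l)

lemma front_vertex {k a : ℕ} (j : Fin (k + 1)) :
    Front a (stdSimplex.vertex j : stdSimplex ℝ (Fin (k + 1))) ↔ (j : ℕ) < a := by
  constructor
  · intro h
    by_contra hj
    simpa using h j (not_lt.1 hj)
  · intro h l hl
    have : l ≠ j := by
      rintro rfl
      omega
    simp [stdSimplex.vertex_coe, this]

lemma isInitial_vertex {k a : ℕ} :
    IsInitial (Front a) (stdSimplex.vertex : Fin (k + 1) → stdSimplex ℝ (Fin (k + 1))) := by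
  intro j l hjl hl
  rw [front_vertex] at hl ⊢
  exact lt_of_le_of_lt hjl hl

/-- The front faces of an affine simplex whose vertices in a front face form an initial segment. -/
lemma exists_front_affineSimplex_iff {k m a : ℕ} {w : Fin (m + 1) → stdSimplex ℝ (Fin (k + 1))}
    (hw : IsInitial (Front a) w) : ∃ a', ∀ t, Front a (affineSimplex w t) ↔ Front a' t := by
  by_cases h : ∀ l, Front a (w l)
  · refine ⟨m + 1, fun t => front_affineSimplex.trans ⟨fun _ j hj => ?_, fun _ l => Or.inr (h l)⟩⟩
    omega
  push Not at h
  have h' : ∃ a', ∃ l : Fin (m + 1), (l : ℕ) = a' ∧ ¬ Front a (w l) := by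
    obtain ⟨l, hl⟩ := h
    exact ⟨l, l, rfl, hl⟩
  -- The initial segment ends just before the first vertex outside the front face.
  refine ⟨Nat.find h', fun t => front_affineSimplex.trans (forall_congr' fun l => ?_)⟩
  rw [or_iff_not_imp_right]
  refine imp_congr ⟨fun hl => Nat.find_min' h' ⟨l, rfl, hl⟩, fun hl hf => ?_⟩ Iff.rfl
  obtain ⟨l', h1, h2⟩ := Nat.find_spec h'
  refine h2 (hw l' l ?_ hf)
  rw [Fin.le_def, h1]
  exact hl

end AffineSimplices

/-! ### Barycentric subdivision of singular chains with the regular differential -/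

section Subdivision

variable {n : ℕ} {X : Type u} [TopologicalSpace X] (R : Type v) [CommRing R]

lemma Sing.face_comp_affineSimplex {k m : ℕ} (σ : Sing k X)
    (w : Fin (m + 2) → stdSimplex ℝ (Fin (k + 1))) (i : Fin (m + 2)) :
    Sing.face i (σ.comp (affineSimplex w) : Sing (m + 1) X) =
      σ.comp (affineSimplex (w ∘ i.succAbove)) := by
  rw [Sing.face, ContinuousMap.comp_assoc, affineSimplex_comp_faceInclusion]

lemma Sing.face_eq_comp_affineSimplex {k : ℕ} (σ : Sing (k + 1) X) (i : Fin (k + 2)) :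
    Sing.face i σ = σ.comp (affineSimplex (stdSimplex.vertex ∘ i.succAbove)) := by
  rw [Sing.face, faceInclusion_eq_affineSimplex]

lemma affineSimplex_comp_vertex {ι : Type*} [Fintype ι] {m : ℕ}
    (w : Fin (m + 1) → stdSimplex ℝ ι) : affineSimplex w ∘ stdSimplex.vertex = w :=
  funext fun j => affineSimplex_vertex w j

/-- The formal simplex given by the vertices of the standard simplex. -/
def fundamental (k : ℕ) : (Fin (k + 1) → stdSimplex ℝ (Fin (k + 1))) →₀ R :=
  Finsupp.single stdSimplex.vertex 1

variable {R} in
lemma linMap_fundamental {k m : ℕ} (w : Fin (m + 1) → stdSimplex ℝ (Fin (k + 1))) :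
    linMap R (affineSimplex w) (m + 1) (fundamental R m) = Finsupp.single w 1 := by
  rw [fundamental, linMap_single, affineSimplex_comp_vertex]

/-- The chain obtained by applying `σ` to a chain of affine simplices; simplices that do not meet
the regular part are dropped. -/
def Filtration.realize (F : Filtration n X) {k : ℕ} (σ : Sing k X) (m : ℕ) :
    ((Fin (m + 1) → stdSimplex ℝ (Fin (k + 1))) →₀ R) →ₗ[R] (Sing m X →₀ R) :=
  Finsupp.linearCombination R fun w =>
    if ∃ t, σ (affineSimplex w t) ∈ F.layer (Fin.last n) then
      Finsupp.single (σ.comp (affineSimplex w)) 1 else 0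

variable (F : Filtration n X)

lemma Filtration.realize_single {k m : ℕ} (σ : Sing k X)
    (w : Fin (m + 1) → stdSimplex ℝ (Fin (k + 1))) :
    F.realize R σ m (Finsupp.single w 1) =
      if ∃ t, σ (affineSimplex w t) ∈ F.layer (Fin.last n) then
        Finsupp.single (σ.comp (affineSimplex w)) 1 else 0 := by
  rw [Filtration.realize, Finsupp.linearCombination_single, one_smul]

lemma Filtration.realize_eq_zero {k m : ℕ} {σ : Sing k X}
    (h : ¬ ∃ t, σ t ∈ F.layer (Fin.last n)) (c) : F.realize R σ m c = 0 := by
  suffices h : F.realize R σ m = 0 from LinearMap.congr_fun h c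
  refine Finsupp.lhom_ext' fun w => LinearMap.ext_ring ?_
  simp only [LinearMap.comp_apply, Finsupp.lsingle_apply, LinearMap.zero_apply]
  rw [F.realize_single R, if_neg]
  rintro ⟨t, ht⟩
  exact h ⟨_, ht⟩

/-- Dropping the simplices that miss the regular part is compatible with the differential, because
all faces of such a simplex miss it too. -/
lemma Filtration.finBd_realize {k m : ℕ} (σ : Sing k X)
    (c : (Fin (m + 2) → stdSimplex ℝ (Fin (k + 1))) →₀ R) :
    F.finBd R m (F.realize R σ (m + 1) c) = F.realize R σ m (linBd R (m + 1) c) := by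
  suffices h : F.finBd R m ∘ₗ F.realize R σ (m + 1) = F.realize R σ m ∘ₗ linBd R (m + 1) from
    LinearMap.congr_fun h c
  refine Finsupp.lhom_ext' fun w => LinearMap.ext_ring ?_
  simp only [LinearMap.comp_apply, Finsupp.lsingle_apply]
  have h1 : F.realize R σ m (linBd R (m + 1) (Finsupp.single w 1)) = ∑ i : Fin (m + 2),
      if ∃ t, σ (affineSimplex (w ∘ i.succAbove) t) ∈ F.layer (Fin.last n) then
        Finsupp.single (σ.comp (affineSimplex (w ∘ i.succAbove))) ((-1 : R) ^ (i : ℕ)) else 0 := by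
    rw [linBd_single, map_sum]
    refine Finset.sum_congr rfl fun i _ => ?_
    rw [Filtration.realize, Finsupp.linearCombination_single, smul_ite, smul_zero,
      Finsupp.smul_single, smul_eq_mul, mul_one]
  rw [h1, F.realize_single R]
  split_ifs with hw
  · rw [Filtration.finBd, Finsupp.linearCombination_single, one_smul, Filtration.bd]
    refine Finset.sum_congr rfl fun i _ => ?_
    rw [Sing.face_comp_affineSimplex]
    rfl
  · rw [map_zero, Finset.sum_eq_zero]
    intro i _
    rw [if_neg]
    rintro ⟨t, ht⟩
    rw [← affineSimplex_comp_faceInclusion] at ht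
    exact hw ⟨_, ht⟩

lemma Filtration.realize_comp {k m l : ℕ} (σ : Sing k X)
    (u : Fin (m + 1) → stdSimplex ℝ (Fin (k + 1)))
    (c : (Fin (l + 1) → stdSimplex ℝ (Fin (m + 1))) →₀ R) :
    F.realize R (σ.comp (affineSimplex u) : Sing m X) l c =
      F.realize R σ l (linMap R (affineSimplex u) (l + 1) c) := by
  suffices h : F.realize R (σ.comp (affineSimplex u) : Sing m X) l =
      F.realize R σ l ∘ₗ linMap R (affineSimplex u) (l + 1) from LinearMap.congr_fun h c
  refine Finsupp.lhom_ext' fun w => LinearMap.ext_ring ?_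
  simp only [LinearMap.comp_apply, Finsupp.lsingle_apply, linMap_single, realize_single]
  rw [← affineSimplex_comp]
  rfl

/-- The barycentric subdivision of singular chains. -/
def Filtration.subdiv (k : ℕ) : (Sing k X →₀ R) →ₗ[R] (Sing k X →₀ R) :=
  Finsupp.linearCombination R fun σ =>
    F.realize R σ k (linSd R (fun m => bary m) (k + 1) (fundamental R k))

/-- The homotopy between the identity and the barycentric subdivision of singular chains. -/
def Filtration.subdivHtpy (k : ℕ) : (Sing k X →₀ R) →ₗ[R] (Sing (k + 1) X →₀ R) :=
  Finsupp.linearCombination R fun σ =>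
    F.realize R σ (k + 1) (linHtpy R (fun m => bary m) (k + 1) (fundamental R k))

/-- The projection of singular chains to the chains of simplices that meet the regular part. -/
def Filtration.regPart (k : ℕ) : (Sing k X →₀ R) →ₗ[R] (Sing k X →₀ R) :=
  Finsupp.linearCombination R fun σ => F.realize R σ k (fundamental R k)

lemma Filtration.realize_fundamental {k : ℕ} (σ : Sing k X) :
    F.realize R σ k (fundamental R k) =
      if ∃ t, σ t ∈ F.layer (Fin.last n) then Finsupp.single σ 1 else 0 := by
  rw [fundamental, F.realize_single R, affineSimplex_id]
  rfl

lemma Filtration.regPart_eq_self {k : ℕ} {c : Sing k X →₀ R}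
    (hc : ∀ σ, c σ ≠ 0 → ∃ t, σ t ∈ F.layer (Fin.last n)) : F.regPart R k c = c := by
  rw [Filtration.regPart, Finsupp.linearCombination_apply]
  conv_rhs => rw [← Finsupp.sum_single c]
  refine Finset.sum_congr rfl fun σ hσ => ?_
  change c σ • F.realize R σ k (fundamental R k) = Finsupp.single σ (c σ)
  rw [F.realize_fundamental R, if_pos (hc σ (by simpa using hσ)), Finsupp.smul_single, smul_eq_mul,
    mul_one]

variable {R F} in
/-- The value on `𝔡σ` of an operator that is defined naturally on affine simplices. -/
lemma Filtration.linearCombination_bd {k m : ℕ}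
    (L : ∀ l, ((Fin (k + 1) → stdSimplex ℝ (Fin (l + 1))) →₀ R) →ₗ[R]
      ((Fin (m + 1) → stdSimplex ℝ (Fin (l + 1))) →₀ R))
    (hL : ∀ (i : Fin (k + 2)) c,
      L (k + 1) (linMap R (affineSimplex (stdSimplex.vertex ∘ i.succAbove)) (k + 1) c) =
        linMap R (affineSimplex (stdSimplex.vertex ∘ i.succAbove)) (m + 1) (L k c))
    (σ : Sing (k + 1) X) :
    Finsupp.linearCombination R (fun τ => F.realize R τ m (L k (fundamental R k))) (F.bd R σ) =
      F.realize R σ m (L (k + 1) (linBd R (k + 1) (fundamental R (k + 1)))) := by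
  rw [show linBd R (k + 1) (fundamental R (k + 1)) = _ from linBd_single R _ _, map_sum, map_sum,
    Filtration.bd, map_sum]
  refine Finset.sum_congr rfl fun i _ => ?_
  have h1 : F.realize R σ m (L (k + 1) (Finsupp.single
      (stdSimplex.vertex ∘ i.succAbove) ((-1 : R) ^ (i : ℕ)))) =
      (-1 : R) ^ (i : ℕ) • F.realize R (Sing.face i σ) m (L k (fundamental R k)) := by
    rw [Sing.face_eq_comp_affineSimplex, F.realize_comp R, ← hL, linMap_fundamental, ← map_smul,
      ← map_smul, Finsupp.smul_single, smul_eq_mul, mul_one]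
  rw [h1]
  -- For a face dropped from the differential the right-hand term vanishes too, since everything
  -- realized in that face is dropped.
  split_ifs with h
  · rw [Finsupp.linearCombination_single]
  · rw [map_zero, F.realize_eq_zero R h, smul_zero]

lemma Filtration.finBd_subdiv (k : ℕ) (c : Sing (k + 1) X →₀ R) :
    F.finBd R k (F.subdiv R (k + 1) c) = F.subdiv R k (F.finBd R k c) := by
  suffices h : F.finBd R k ∘ₗ F.subdiv R (k + 1) = F.subdiv R k ∘ₗ F.finBd R k from
    LinearMap.congr_fun h c
  refine Finsupp.lhom_ext' fun σ => LinearMap.ext_ring ?_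
  simp only [LinearMap.comp_apply, Finsupp.lsingle_apply]
  rw [Filtration.subdiv, Filtration.finBd, Finsupp.linearCombination_single, one_smul,
    Finsupp.linearCombination_single, one_smul, ← Filtration.finBd, F.finBd_realize R, linBd_linSd,
    Filtration.subdiv]
  exact (Filtration.linearCombination_bd (fun l => linSd R (fun m => bary m) (k + 1))
    (fun i c => linSd_linMap R (fun m w => affineSimplex_bary _ m w) _ c) σ).symm

lemma Filtration.finBd_subdivHtpy_zero (c : Sing 0 X →₀ R) :
    F.finBd R 0 (F.subdivHtpy R 0 c) = F.regPart R 0 c - F.subdiv R 0 c := by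
  suffices h : F.finBd R 0 ∘ₗ F.subdivHtpy R 0 = F.regPart R 0 - F.subdiv R 0 from
    LinearMap.congr_fun h c
  refine Finsupp.lhom_ext' fun σ => LinearMap.ext_ring ?_
  simp only [LinearMap.comp_apply, Finsupp.lsingle_apply, LinearMap.sub_apply]
  rw [Filtration.subdivHtpy, Filtration.subdiv, Filtration.regPart,
    Finsupp.linearCombination_single, one_smul, Finsupp.linearCombination_single, one_smul,
    Finsupp.linearCombination_single, one_smul, F.finBd_realize R, ← map_sub, ← linBd_linHtpy]
  simp [linHtpy]

lemma Filtration.finBd_subdivHtpy (k : ℕ) (c : Sing (k + 1) X →₀ R) :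
    F.finBd R (k + 1) (F.subdivHtpy R (k + 1) c) + F.subdivHtpy R k (F.finBd R k c) =
      F.regPart R (k + 1) c - F.subdiv R (k + 1) c := by
  suffices h : F.finBd R (k + 1) ∘ₗ F.subdivHtpy R (k + 1) + F.subdivHtpy R k ∘ₗ F.finBd R k =
      F.regPart R (k + 1) - F.subdiv R (k + 1) from LinearMap.congr_fun h c
  refine Finsupp.lhom_ext' fun σ => LinearMap.ext_ring ?_
  simp only [LinearMap.comp_apply, Finsupp.lsingle_apply, LinearMap.sub_apply,
    LinearMap.add_apply]
  have h1 : F.subdivHtpy R k (F.finBd R k (Finsupp.single σ 1)) = F.realize R σ (k + 1)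
      (linHtpy R (fun m => bary m) (k + 1) (linBd R (k + 1) (fundamental R (k + 1)))) := by
    rw [Filtration.finBd, Finsupp.linearCombination_single, one_smul]
    exact Filtration.linearCombination_bd (fun l => linHtpy R (fun m => bary m) (k + 1))
      (fun i c => linHtpy_linMap R (fun m w => affineSimplex_bary _ m w) _ c) σ
  rw [h1, Filtration.subdivHtpy, Filtration.subdiv, Filtration.regPart,
    Finsupp.linearCombination_single, one_smul, Finsupp.linearCombination_single, one_smul,
    Finsupp.linearCombination_single, one_smul, F.finBd_realize R, ← map_sub, ← linBd_linHtpy,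
    map_add]

lemma Filtration.subdiv_realize {k m : ℕ} (σ : Sing k X)
    (c : (Fin (m + 1) → stdSimplex ℝ (Fin (k + 1))) →₀ R) :
    F.subdiv R m (F.realize R σ m c) =
      F.realize R σ m (linSd R (fun m => bary m) (m + 1) c) := by
  suffices h : F.subdiv R m ∘ₗ F.realize R σ m =
      F.realize R σ m ∘ₗ linSd R (fun m => bary m) (m + 1) from LinearMap.congr_fun h c
  refine Finsupp.lhom_ext' fun w => LinearMap.ext_ring ?_
  simp only [LinearMap.comp_apply, Finsupp.lsingle_apply]
  have h1 : F.realize R σ m (linSd R (fun m => bary m) (m + 1) (Finsupp.single w 1)) =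
      F.realize R (σ.comp (affineSimplex w) : Sing m X) m
        (linSd R (fun m => bary m) (m + 1) (fundamental R m)) := by
    rw [F.realize_comp R, ← linSd_linMap R (fun m w => affineSimplex_bary _ m w),
      linMap_fundamental]
  rw [h1, F.realize_single R]
  split_ifs with hw
  · rw [Filtration.subdiv, Finsupp.linearCombination_single, one_smul]
  · rw [map_zero, F.realize_eq_zero R]
    exact hw

/-- This moves the iteration into the standard simplex, where the mesh estimate applies. The
projection `regPart` accounts for the case `r = 0`; it fixes allowable chains. -/
lemma Filtration.subdiv_iterate {k : ℕ} (r : ℕ) (c : Sing k X →₀ R) :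
    (F.subdiv R k)^[r] (F.regPart R k c) = Finsupp.linearCombination R (fun σ =>
      F.realize R σ k ((linSd R (fun m => bary m) (k + 1))^[r] (fundamental R k))) c := by
  induction r with
  | zero => rfl
  | succ r ih =>
    rw [Function.iterate_succ_apply', ih, Finsupp.linearCombination_apply,
      Finsupp.linearCombination_apply, Finsupp.sum, map_sum]
    refine Finset.sum_congr rfl fun σ _ => ?_
    rw [map_smul, F.subdiv_realize R, Function.iterate_succ_apply']

variable {R F}

lemma Filtration.exists_of_realize_ne_zero {k m : ℕ} {σ : Sing k X}
    {c : (Fin (m + 1) → stdSimplex ℝ (Fin (k + 1))) →₀ R} {τ : Sing m X}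
    (h : F.realize R σ m c τ ≠ 0) : ∃ w, c w ≠ 0 ∧ τ = σ.comp (affineSimplex w) := by
  obtain ⟨w, hw, hw'⟩ := exists_single_of_map_ne_zero _ h
  refine ⟨w, hw, ?_⟩
  rw [F.realize_single R] at hw'
  split_ifs at hw' with h1
  · by_contra H
    exact hw' (Finsupp.single_eq_of_ne H)
  · exact absurd rfl hw'

lemma Filtration.exists_of_linearCombination_realize_ne_zero {k m : ℕ} {c : Sing k X →₀ R}
    {a : (Fin (m + 1) → stdSimplex ℝ (Fin (k + 1))) →₀ R} {τ : Sing m X}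
    (h : Finsupp.linearCombination R (fun σ => F.realize R σ m a) c τ ≠ 0) :
    ∃ σ w, c σ ≠ 0 ∧ a w ≠ 0 ∧ τ = σ.comp (affineSimplex w) := by
  obtain ⟨σ, hσ, hσ'⟩ := exists_single_of_map_ne_zero _ h
  rw [Finsupp.linearCombination_single, one_smul] at hσ'
  obtain ⟨w, hw, rfl⟩ := Filtration.exists_of_realize_ne_zero hσ'
  exact ⟨σ, w, hσ, hw, rfl⟩

end Subdivision

/-! ### Subdivision of intersection chains and excision -/

section Excision

variable {n : ℕ} {X : Type u} [TopologicalSpace X] {R : Type v} [CommRing R]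
  {F : Filtration n X} {p : Perversity F}

/-- An affine simplex in an allowable simplex is allowable if it is compatible with the front
faces and does not meet them in too large a dimension. -/
lemma Perversity.IsAllowable.comp_affineSimplex {k m d : ℕ} {σ : Sing k X} (h : p.IsAllowable σ)
    (hm : m = k + d) {w : Fin (m + 1) → stdSimplex ℝ (Fin (k + 1))}
    (hw : ∀ a, IsInitial (Front a) w ∧
      countIn (Front a) w ≤ countIn (Front a) (stdSimplex.vertex : Fin (k + 1) → _) + d ∧
      ((∀ j, Front a (w j)) →
        ∀ j, Front a (stdSimplex.vertex j : stdSimplex ℝ (Fin (k + 1))))) :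
    p.IsAllowable (σ.comp (affineSimplex w) : Sing m X) := by
  obtain ⟨⟨hreg, t₀, ht₀⟩, hall⟩ := h
  refine ⟨⟨fun i => ?_, stdSimplex.barycenter, ?_, ?_⟩, fun S => ?_⟩
  · obtain ⟨a, ha⟩ := hreg i
    obtain ⟨a', ha'⟩ := exists_front_affineSimplex_iff (hw a).1
    exact ⟨a', fun t => (ha _).trans (ha' t)⟩
  · rw [F.skel_last]
    trivial
  -- If the barycentre of the affine simplex lay in a front face mapped to a lower skeleton, all its
  -- vertices would. By the last clause of `hw` the front face would then be the whole simplex,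
  -- including the regular point `t₀`.
  · intro j hj hmem
    obtain ⟨a, ha⟩ := hreg j
    have h1 : Front a (bary m w) := (ha _).1 hmem
    have h2 := (hw a).2.2 ((front_bary m w).1 h1)
    have h3 : Front a (affineSimplex stdSimplex.vertex t₀) :=
      front_affineSimplex.2 fun l => Or.inr (h2 l)
    rw [affineSimplex_id] at h3
    exact ht₀.2 j hj ((ha _).2 h3)
  · have h1 := hall S
    unfold Filtration.perverseDegree at h1 ⊢
    split_ifs with hS
    swap
    · exact bot_le
    obtain ⟨t, ht⟩ := hS
    have hsk : (σ.comp (affineSimplex w) : Sing m X) t ∈ F.skel S.dim := ht.1.1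
    rw [if_pos ⟨_, ht⟩] at h1
    unfold Filtration.preimageDim at h1 ⊢
    rw [if_pos ⟨_, hsk⟩] at h1
    rw [if_pos ⟨t, hsk⟩]
    rw [WithBot.coe_le_coe] at h1 ⊢
    obtain ⟨a, ha⟩ := hreg S.dim
    have e1 : (Finset.univ.filter fun j : Fin (k + 1) =>
        σ (stdSimplex.vertex j) ∈ F.skel S.dim).card =
          countIn (Front a) (stdSimplex.vertex : Fin (k + 1) → _) := by
      refine congrArg Finset.card (Finset.filter_congr fun j _ => ha _)
    have e2 : (Finset.univ.filter fun j : Fin (m + 1) =>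
        (σ.comp (affineSimplex w) : Sing m X) (stdSimplex.vertex j) ∈ F.skel S.dim).card =
          countIn (Front a) w := by
      refine congrArg Finset.card (Finset.filter_congr fun j _ => ?_)
      rw [ContinuousMap.comp_apply, affineSimplex_vertex]
      exact ha _
    rw [e1] at h1
    rw [e2]
    -- The preimage of the skeleton gains at most `d` vertices, while the bound on its dimension
    -- grows by exactly `d`.
    have h2 := (hw a).2.1
    subst hm
    push_cast
    zify at h2
    linarith

lemma Perversity.subdiv_mem_allowableChains {k : ℕ} {c : Sing k X →₀ R}
    (hc : c ∈ p.allowableChains R k) : F.subdiv R k c ∈ p.allowableChains R k := by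
  rw [p.mem_allowableChains] at hc ⊢
  intro τ hτ
  obtain ⟨σ, w, hσ, hw, rfl⟩ := Filtration.exists_of_linearCombination_realize_ne_zero hτ
  exact (hc σ hσ).comp_affineSimplex (d := 0) rfl fun a =>
    linSd_face (fun m w => front_bary m w) hw isInitial_vertex

lemma Perversity.subdivHtpy_mem_allowableChains {k : ℕ} {c : Sing k X →₀ R}
    (hc : c ∈ p.allowableChains R k) : F.subdivHtpy R k c ∈ p.allowableChains R (k + 1) := by
  rw [p.mem_allowableChains] at hc ⊢
  intro τ hτ
  obtain ⟨σ, w, hσ, hw, rfl⟩ := Filtration.exists_of_linearCombination_realize_ne_zero hτ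
  exact (hc σ hσ).comp_affineSimplex (d := 1) rfl fun a =>
    linHtpy_face (fun m w => front_bary m w) hw isInitial_vertex

lemma Perversity.regPart_eq_self {k : ℕ} {c : Sing k X →₀ R} (hc : c ∈ p.allowableChains R k) :
    F.regPart R k c = c :=
  F.regPart_eq_self R fun σ hσ => (p.mem_allowableChains.1 hc σ hσ).1.2

lemma Perversity.subdiv_mem_chains {k : ℕ} {c : Sing k X →₀ R} (hc : c ∈ p.chains R k) :
    F.subdiv R k c ∈ p.chains R k := by
  cases k with
  | zero => exact p.subdiv_mem_allowableChains hc
  | succ k =>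
    refine ⟨p.subdiv_mem_allowableChains hc.1, ?_⟩
    change F.finBd R k (F.subdiv R (k + 1) c) ∈ p.allowableChains R k
    rw [F.finBd_subdiv R]
    exact p.subdiv_mem_allowableChains hc.2

/-- The homotopy formula expresses the differential of Tc through c, its subdivision and T∂c; the
last is allowable because ∂c is. -/
lemma Perversity.subdivHtpy_mem_chains {k : ℕ} {c : Sing k X →₀ R} (hc : c ∈ p.chains R k) :
    F.subdivHtpy R k c ∈ p.chains R (k + 1) := by
  have hall := p.chains_le k hc
  refine ⟨p.subdivHtpy_mem_allowableChains hall, ?_⟩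
  change F.finBd R k (F.subdivHtpy R k c) ∈ p.allowableChains R k
  cases k with
  | zero =>
    rw [F.finBd_subdivHtpy_zero R, p.regPart_eq_self hall]
    exact sub_mem hall (p.subdiv_mem_allowableChains hall)
  | succ k =>
    rw [eq_sub_of_add_eq (F.finBd_subdivHtpy R k c), p.regPart_eq_self hall]
    exact sub_mem (sub_mem hall (p.subdiv_mem_allowableChains hall))
      (p.subdivHtpy_mem_allowableChains hc.2)

variable (R p)

/-- The barycentric subdivision of `p`-intersection chains. -/
def Perversity.sd (k : ℕ) : p.Chains R k →ₗ[R] p.Chains R k :=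
  (F.subdiv R k).restrict fun _ hc => p.subdiv_mem_chains hc

/-- The homotopy between the identity and the subdivision of `p`-intersection chains. -/
def Perversity.sdHtpy (k : ℕ) : p.Chains R k →ₗ[R] p.Chains R (k + 1) :=
  (F.subdivHtpy R k).restrict fun _ hc => p.subdivHtpy_mem_chains hc

variable {R p}

lemma Perversity.sd_coe {k : ℕ} (c : p.Chains R k) : (p.sd R k c).1 = F.subdiv R k c.1 := rfl

lemma Perversity.d_sd {k : ℕ} (c : p.Chains R (k + 1)) :
    p.d R k (p.sd R (k + 1) c) = p.sd R k (p.d R k c) :=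
  Subtype.ext (F.finBd_subdiv R k c.1)

lemma Perversity.d_sdHtpy_zero (c : p.Chains R 0) :
    p.d R 0 (p.sdHtpy R 0 c) = c - p.sd R 0 c :=
  Subtype.ext ((F.finBd_subdivHtpy_zero R c.1).trans (by
    rw [p.regPart_eq_self (p.chains_le 0 c.2)]
    rfl))

lemma Perversity.d_sdHtpy {k : ℕ} (c : p.Chains R (k + 1)) :
    p.d R (k + 1) (p.sdHtpy R (k + 1) c) + p.sdHtpy R k (p.d R k c) = c - p.sd R (k + 1) c :=
  Subtype.ext ((F.finBd_subdivHtpy R k c.1).trans (by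
    rw [p.regPart_eq_self (p.chains_le (k + 1) c.2)]
    rfl))

lemma Perversity.sd_mem_subChains {A : Set X} {k : ℕ} {c : p.Chains R k}
    (hc : c ∈ p.subChains R A k) : p.sd R k c ∈ p.subChains R A k := by
  rw [p.mem_subChains] at hc ⊢
  intro τ hτ t
  obtain ⟨σ, w, hσ, -, rfl⟩ := Filtration.exists_of_linearCombination_realize_ne_zero hτ
  exact hc σ hσ _

lemma Perversity.sdHtpy_mem_subChains {A : Set X} {k : ℕ} {c : p.Chains R k}
    (hc : c ∈ p.subChains R A k) : p.sdHtpy R k c ∈ p.subChains R A (k + 1) := by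
  rw [p.mem_subChains] at hc ⊢
  intro τ hτ t
  obtain ⟨σ, w, hσ, -, rfl⟩ := Filtration.exists_of_linearCombination_realize_ne_zero hτ
  exact hc σ hσ _

lemma sup_le_comap_sup {M N : Type*} [AddCommGroup M] [AddCommGroup N] [Module R M]
    [Module R N] {f : M →ₗ[R] N} {A B : Submodule R M} {A' B' : Submodule R N}
    (hA : A ≤ A'.comap f) (hB : B ≤ B'.comap f) : A ⊔ B ≤ (A' ⊔ B').comap f :=
  sup_le (hA.trans (Submodule.comap_mono le_sup_left))
    (hB.trans (Submodule.comap_mono le_sup_right))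

/-! ### Small chains -/

lemma dist_vertex_le_one {k : ℕ} (i j : Fin (k + 1)) :
    dist (stdSimplex.vertex i : stdSimplex ℝ (Fin (k + 1))) (stdSimplex.vertex j) ≤ 1 :=
  (Metric.dist_le_diam_of_mem (bounded_stdSimplex _) (stdSimplex.vertex i).2
    (stdSimplex.vertex j).2).trans diam_stdSimplex_le

/-- The simplices of the iterated subdivisions are eventually small with respect to an open
cover. -/
lemma Sing.exists_small {k : ℕ} (σ : Sing k X) {ι : Type*} {V : ι → Set X}
    (hV : ∀ i, IsOpen (V i)) (hcov : ⋃ i, V i = Set.univ) : ∃ r₀ : ℕ, ∀ r ≥ r₀,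
      ∀ w, (linSd R (fun m => bary m) (k + 1))^[r] (fundamental R k) w ≠ 0 →
        ∃ i, ∀ t, σ (affineSimplex w t) ∈ V i := by
  obtain ⟨δ, hδ, hball⟩ := lebesgue_number_lemma_of_metric
    (s := (Set.univ : Set (stdSimplex ℝ (Fin (k + 1))))) (c := fun i => σ ⁻¹' V i)
    isCompact_univ (fun i => (hV i).preimage σ.continuous) (by
      rw [← Set.preimage_iUnion, hcov, Set.preimage_univ])
  -- Vertices of the standard simplex have distance at most 1, so after `r` subdivisions the mesh is
  -- at most (k / (k + 1)) ^ r. It has to drop below the Lebesgue number `δ` of the pulled-back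
  -- cover.
  obtain ⟨r₀, hr₀⟩ := exists_pow_lt_of_lt_one hδ
    (show (k : ℝ) / (k + 1) < 1 by rw [div_lt_one (by positivity)]; linarith)
  refine ⟨r₀, fun r hr w hw => ?_⟩
  have hmesh := linSd_iterate_mesh (b := fun m => bary m)
    (fun m w x r h => dist_affineSimplex_le h _)
    (fun m w D h => dist_bary_le h) r hw dist_vertex_le_one
  obtain ⟨i, hi⟩ := hball (w 0) trivial
  refine ⟨i, fun t => hi ?_⟩
  rw [Metric.mem_ball]
  refine (dist_affineSimplex_le (fun j => hmesh j 0) t).trans_lt ?_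
  rw [mul_one]
  exact (pow_le_pow_of_le_one (by positivity) (div_le_one_of_le₀ (by linarith) (by positivity))
    hr).trans_lt hr₀

lemma Perversity.sd_iterate_coe {k : ℕ} (r : ℕ) (c : p.Chains R k) :
    ((p.sd R k)^[r] c).1 = (F.subdiv R k)^[r] c.1 := by
  induction r with
  | zero => rfl
  | succ r ih => rw [Function.iterate_succ_apply', Function.iterate_succ_apply', sd_coe, ih]

lemma Perversity.exists_sd_small {k : ℕ} (c : p.Chains R k) {ι : Type*} {V : ι → Set X}
    (hV : ∀ i, IsOpen (V i)) (hcov : ⋃ i, V i = Set.univ) : ∃ r : ℕ,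
      ∀ τ, ((p.sd R k)^[r] c).1 τ ≠ 0 → ∃ i, ∀ t, τ t ∈ V i := by
  choose r₀ hr₀ using fun σ : Sing k X => σ.exists_small (R := R) hV hcov
  -- Finitely many simplices occur in `c`, and smallness persists under further subdivision, so the
  -- maximum works for all of them.
  refine ⟨c.1.support.sup r₀, fun τ hτ => ?_⟩
  have h := F.subdiv_iterate R (c.1.support.sup r₀) c.1
  rw [p.regPart_eq_self (p.chains_le k c.2)] at h
  rw [p.sd_iterate_coe, h] at hτ
  obtain ⟨σ, w, hσ, hw, rfl⟩ := Filtration.exists_of_linearCombination_realize_ne_zero hτ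
  exact hr₀ σ _ (Finset.le_sup (by simpa using hσ)) w hw

/-- The part of a `p`-intersection chain formed by the simplices with first vertex in a given set
is a `p`-intersection chain. -/
lemma Perversity.filter_mem_chains {k : ℕ} {c : Sing k X →₀ R} (hc : c ∈ p.chains R k)
    (W : Set X) : c.filter (fun σ => σ (stdSimplex.vertex 0) ∈ W) ∈ p.chains R k := by
  have hall : c.filter (fun σ => σ (stdSimplex.vertex 0) ∈ W) ∈ p.allowableChains R k := by
    rw [p.mem_allowableChains]
    intro σ hσ
    refine p.mem_allowableChains.1 (p.chains_le k hc) σ fun h0 => hσ ?_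
    rw [Finsupp.filter_apply, h0, ite_self]
  cases k with
  | zero => exact hall
  | succ k =>
    refine ⟨hall, ?_⟩
    change F.finBd R k _ ∈ p.allowableChains R k
    rw [p.mem_allowableChains]
    intro τ hτ
    by_contra hna
    have hface : ∀ σ, c σ ≠ 0 → F.bd R σ τ ≠ 0 →
        σ (stdSimplex.vertex 0) = τ (stdSimplex.vertex 0) := by
      intro σ h1 h2
      obtain ⟨i, rfl, h4⟩ := Filtration.exists_face_of_bd_ne_zero R h2
      exact ((p.mem_allowableChains.1 hc.1 σ h1).face_zero_vertex i h4 hna).symm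
    rw [F.finBd_apply R] at hτ
    obtain ⟨σ, hσ⟩ := exists_of_finsum_ne_zero hτ
    have hτW : τ (stdSimplex.vertex 0) ∈ W := by
      have h1 := left_ne_zero_of_mul hσ
      rw [Finsupp.filter_apply] at h1
      split_ifs at h1 with hW
      · rwa [← hface σ h1 (right_ne_zero_of_mul hσ)]
      · exact absurd rfl h1
    -- All simplices of `c` contributing to the bad face τ start at the first vertex of τ, which
    -- lies in `W`. None of them is filtered out, so τ has the same non-zero coefficient in the
    -- differential of `c`, which is allowable.
    refine hna (p.mem_allowableChains.1 hc.2 τ ?_)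
    rw [F.finBd_apply R]
    convert hτ using 1
    refine finsum_congr fun σ => ?_
    by_cases h0 : F.bd R σ τ = 0
    · simp [h0]
    by_cases h1 : c σ = 0
    · rw [Finsupp.filter_apply, h1, ite_self]
    rw [Finsupp.filter_apply, if_pos]
    rwa [hface σ h1 h0]

/-- Choose an open W with K ⊆ W and closure in U, and subdivide until every simplex lies in W, in U
\ K or in the complement of the closure of W. A simplex with first vertex in W is not of the third
kind, hence lies in U. A simplex with first vertex outside W is not of the first kind, hence misses
K. -/
lemma Perversity.exists_sd_mem_sup [T2Space X] [LocallyCompactSpace X] {U K : Set X}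
    (hU : IsOpen U) (hK : IsCompact K) (hKU : K ⊆ U) {k : ℕ} (c : p.Chains R k) :
    ∃ r : ℕ, (p.sd R k)^[r] c ∈ p.subChains R U k ⊔ p.subChains R Kᶜ k := by
  obtain ⟨W, hW, hKW, hWU, -⟩ := exists_open_between_and_isCompact_closure hK hU hKU
  let V : Fin 3 → Set X := ![W, U \ K, (closure W)ᶜ]
  have hV : ∀ i, IsOpen (V i) := by
    rw [Fin.forall_fin_succ, Fin.forall_fin_two]
    exact ⟨hW, hU.sdiff hK.isClosed, isClosed_closure.isOpen_compl⟩
  have hcov : ⋃ i, V i = Set.univ := by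
    refine Set.eq_univ_of_forall fun x => Set.mem_iUnion.2 ?_
    by_cases hx : x ∈ W
    · exact ⟨0, hx⟩
    by_cases hx' : x ∈ closure W
    · exact ⟨1, hWU hx', fun h => hx (hKW h)⟩
    · exact ⟨2, hx'⟩
  obtain ⟨r, hr⟩ := p.exists_sd_small c hV hcov
  refine ⟨r, ?_⟩
  set c' := (p.sd R k)^[r] c
  let a : p.Chains R k := ⟨_, p.filter_mem_chains c'.2 W⟩
  have ha : a ∈ p.subChains R U k := by
    rw [p.mem_subChains]
    intro σ hσ t
    change (c'.1.filter _) σ ≠ 0 at hσ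
    rw [Finsupp.filter_apply] at hσ
    split_ifs at hσ with hv
    · obtain ⟨i, hi⟩ := hr σ hσ
      fin_cases i
      · exact hWU (subset_closure (hi t))
      · exact (hi t).1
      · exact absurd (subset_closure hv) (hi (stdSimplex.vertex 0))
    · exact absurd rfl hσ
  have ha' : c' - a ∈ p.subChains R Kᶜ k := by
    rw [p.mem_subChains]
    intro σ hσ t
    change c'.1 σ - (c'.1.filter _) σ ≠ 0 at hσ
    rw [Finsupp.filter_apply] at hσ
    split_ifs at hσ with hv
    · exact absurd (sub_self _) hσ
    · rw [sub_zero] at hσ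
      obtain ⟨i, hi⟩ := hr σ hσ
      fin_cases i
      · exact absurd (hi (stdSimplex.vertex 0)) hv
      · exact (hi t).2
      · exact fun h => hi t (subset_closure (hKW h))
  rw [← add_sub_cancel a c']
  exact add_mem (Submodule.mem_sup_left ha) (Submodule.mem_sup_right ha')

/-! ### Excision -/

/-- The condition that the differential of `c` lies in a given submodule; in degree zero it is
empty. -/
def Perversity.BdIn (S : ∀ k, Submodule R (p.Chains R k)) : ∀ k, p.Chains R k → Prop
  | 0, _ => True
  | k + 1, c => p.d R k c ∈ S k

variable (R p) in
/-- The chains of `X` that are sums of a chain of `U` and a chain of `X \ K`. -/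
def Perversity.sumChains (U K : Set X) (k : ℕ) : Submodule R (p.Chains R k) :=
  p.subChains R U k ⊔ p.subChains R Kᶜ k

/-- Excision: the quotient of `C(X)` by `C(U) + C(X \ K)` is acyclic. -/
lemma Perversity.excision [T2Space X] [LocallyCompactSpace X] {U K : Set X}
    (hU : IsOpen U) (hK : IsCompact K) (hKU : K ⊆ U) {k : ℕ} (c : p.Chains R k)
    (hc : p.BdIn (p.sumChains R U K) k c) :
    ∃ e, c - p.d R k e ∈ p.sumChains R U K k := by
  have hsd : ∀ k, p.sumChains R U K k ≤ (p.sumChains R U K k).comap (p.sd R k) := fun k =>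
    sup_le_comap_sup (fun _ h => p.sd_mem_subChains h) fun _ h => p.sd_mem_subChains h
  have hhtpy : ∀ k, p.sumChains R U K k ≤ (p.sumChains R U K (k + 1)).comap (p.sdHtpy R k) :=
    fun k => sup_le_comap_sup (fun _ h => p.sdHtpy_mem_subChains h)
      fun _ h => p.sdHtpy_mem_subChains h
  -- Up to a boundary, `c` and its subdivision differ by T∂c, which lies in the sum because ∂c does
  -- and T preserves both summands.
  have step : ∀ c : p.Chains R k, p.BdIn (p.sumChains R U K) k c →
      p.BdIn (p.sumChains R U K) k (p.sd R k c) ∧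
        ∃ e, c - p.d R k e - p.sd R k c ∈ p.sumChains R U K k := by
    intro c hc
    cases k with
    | zero =>
      refine ⟨trivial, p.sdHtpy R 0 c, ?_⟩
      rw [p.d_sdHtpy_zero, sub_sub_cancel, sub_self]
      exact zero_mem _
    | succ k =>
      refine ⟨?_, p.sdHtpy R (k + 1) c, ?_⟩
      · change p.d R k (p.sd R (k + 1) c) ∈ _
        rw [p.d_sd]
        exact hsd k hc
      · rw [eq_sub_of_add_eq (p.d_sdHtpy c)]
        have : c - (c - p.sd R (k + 1) c - p.sdHtpy R k (p.d R k c)) - p.sd R (k + 1) c =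
            p.sdHtpy R k (p.d R k c) := by abel
        rw [this]
        exact hhtpy k hc
  have iter : ∀ r : ℕ, p.BdIn (p.sumChains R U K) k ((p.sd R k)^[r] c) ∧
      ∃ e, c - p.d R k e - (p.sd R k)^[r] c ∈ p.sumChains R U K k := by
    intro r
    induction r with
    | zero =>
      refine ⟨hc, 0, ?_⟩
      simp
    | succ r ih =>
      obtain ⟨h1, e, he⟩ := ih
      rw [Function.iterate_succ_apply']
      obtain ⟨h2, e', he'⟩ := step _ h1
      refine ⟨h2, e + e', ?_⟩
      rw [map_add]
      convert add_mem he he' using 1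
      abel
  obtain ⟨r, hr⟩ := p.exists_sd_mem_sup hU hK hKU c
  obtain ⟨-, e, he⟩ := iter r
  refine ⟨e, ?_⟩
  convert add_mem he hr using 1
  abel

end Excision

/-! ### The inverse limit: injectivity, gluing and acyclicity of the cokernel -/

section InverseLimit

variable {n : ℕ} {X : Type u} [TopologicalSpace X] {R : Type v} [CommRing R]
  {F : Filtration n X} {p : Perversity F} {U : Set X}

/-- The image of a singular simplex of `U`, as a compact subset. -/
def Sing.image {k : ℕ} (σ : Sing k U) : CompactIn U :=
  ⟨Set.range σ.push, isCompact_range σ.push.continuous, by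
    rintro _ ⟨t, rfl⟩
    exact (σ t).2⟩

/-- The union of two compact subsets. -/
def CompactIn.union (K K' : CompactIn U) : CompactIn U :=
  ⟨K.1 ∪ K'.1, K.2.1.union K'.2.1, Set.union_subset K.2.2 K'.2.2⟩

lemma Perversity.mem_range_pushInter {k : ℕ} {c : p.Chains R k} (hc : c ∈ p.subChains R U k) :
    ∃ c' : (p.restrict U).Chains R k, p.pushInter c' = c := by
  obtain ⟨c', hc', h⟩ := hc
  exact ⟨⟨c', hc'⟩, Subtype.ext h⟩

lemma Perversity.pushInter_mem {k : ℕ} (c : (p.restrict U).Chains R k) :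
    p.pushInter c ∈ p.subChains R U k :=
  ⟨c.1, c.2, rfl⟩

lemma Perversity.apply_eq_of_mk_eq {A : Set X} {k : ℕ} {c c' : p.Chains R k}
    (h : (Submodule.Quotient.mk c : p.RelChains R A k) = Submodule.Quotient.mk c') {σ : Sing k X}
    (hσ : ∃ t, σ t ∉ A) : c.1 σ = c'.1 σ := by
  rw [Submodule.Quotient.eq, p.mem_subChains] at h
  by_contra H
  obtain ⟨t, ht⟩ := hσ
  exact ht (h σ (fun h0 : c.1 σ - c'.1 σ = 0 => H (sub_eq_zero.1 h0)) t)

/-- A relative chain of (X, X \ K) determines the coefficients of all simplices that meet K; for σ,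
take K to be the image of σ. -/
lemma Perversity.naturalMap_injective (k : ℕ) : Function.Injective (p.naturalMap R U k) := by
  refine (injective_iff_map_eq_zero _).2 fun ξ hξ => ?_
  refine Subtype.ext (Subtype.ext (funext fun σ => ?_))
  have h1 : p.restrictAt ξ σ.image = Submodule.Quotient.mk 0 := congrFun (congrArg Subtype.val hξ) _
  have h2 := p.apply_eq_of_mk_eq h1 (σ := σ.push)
    ⟨stdSimplex.vertex 0, fun h => h ⟨_, rfl⟩⟩
  have h3 := p.finitePart_apply ξ σ.image σ ⟨stdSimplex.vertex 0, _, rfl⟩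
  rw [← pushChain_apply_push] at h3
  exact h3.symm.trans h2

/-- An element of the inverse limit that is given by chains of `U` comes from a locally finite
chain of `U`. -/
lemma Perversity.mem_range_naturalMap [LocallyCompactSpace U] {k : ℕ} {α : p.limChains R U k}
    (h : ∀ K, ∃ c : (p.restrict U).Chains R k, α.1 K = Submodule.Quotient.mk (p.pushInter c)) :
    ∃ ξ, p.naturalMap R U k ξ = α := by
  choose c hc using h
  -- Every compact set that meets σ determines the same coefficient; the image of σ is a canonical
  -- choice.
  let ξ : Sing k U → R := fun σ => (c σ.image).1 σ
  have hmono : ∀ (K K' : CompactIn U) (_ : K.1 ⊆ K'.1) (σ : Sing k U),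
      (∃ t, (σ t : X) ∈ K.1) → (c K').1 σ = (c K).1 σ := by
    intro K K' hKK' σ ⟨t, ht⟩
    have h1 := α.2 K K' hKK'
    rw [hc, hc] at h1
    have h2 := p.apply_eq_of_mk_eq (σ := σ.push) h1 ⟨t, fun h => h ht⟩
    exact (pushChain_apply_push (c K').1 σ).symm.trans
      (h2.trans (pushChain_apply_push (c K).1 σ))
  -- Neither of `K` and the image of σ need contain the other, so both are compared with their
  -- union.
  have hξ : ∀ (K : CompactIn U) (σ : Sing k U), (∃ t, (σ t : X) ∈ K.1) → (c K).1 σ = ξ σ := by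
    intro K σ hσ
    exact (hmono K (K.union σ.image) Set.subset_union_left σ hσ).symm.trans
      (hmono σ.image (K.union σ.image) Set.subset_union_right σ ⟨stdSimplex.vertex 0, _, rfl⟩)
  have hlf : ξ ∈ lfChains R k U := by
    intro x
    obtain ⟨C, hC, hCx⟩ := exists_compact_mem_nhds x
    let K : CompactIn U := ⟨Subtype.val '' C, hC.image continuous_subtype_val, by
      rintro _ ⟨y, -, rfl⟩
      exact y.2⟩
    -- All simplices of ξ that meet the compact neighbourhood `C` occur in one finite chain.
    refine ⟨C, hCx, (c K).1.support.finite_toSet.subset ?_⟩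
    rintro σ ⟨h0, t, ht⟩
    rw [← hξ K σ ⟨t, _, ht, rfl⟩] at h0
    simpa using h0
  have hall : (⟨ξ, hlf⟩ : lfChains R k U) ∈ (p.restrict U).lfAllowableChains R k :=
    fun σ hσ => (p.restrict U).mem_allowableChains.1
      ((p.restrict U).chains_le k (c σ.image).2) σ hσ
  have hmem : (⟨ξ, hlf⟩ : lfChains R k U) ∈ (p.restrict U).lfInterChains R k := by
    cases k with
    | zero => exact hall
    | succ k =>
      refine ⟨hall, fun τ hτ => ?_⟩
      change (F.restrict U).lfBd R ξ τ ≠ 0 at hτ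
      -- Every simplex with face τ meets the image of τ, so the chain chosen there has the same
      -- differential at τ as ξ.
      rw [(F.restrict U).lfBd_eq_finBd (c := (c τ.image).1)] at hτ
      · exact (p.restrict U).mem_allowableChains.1 (c τ.image).2.2 τ hτ
      · rintro i σ rfl
        exact hξ _ σ ⟨_, stdSimplex.vertex 0, rfl⟩
  refine ⟨⟨_, hmem⟩, Subtype.ext (funext fun K => ?_)⟩
  rw [hc]
  exact p.restrictAt_eq ⟨_, hmem⟩ K (c K) fun σ hσ => hξ K σ hσ

lemma exists_exhaustion [LocallyCompactSpace U] [SigmaCompactSpace U] :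
    ∃ E : ℕ → CompactIn U, Monotone (fun j => (E j).1) ∧
      ∀ K : CompactIn U, ∃ j, K.1 ⊆ (E j).1 := by
  let C : CompactExhaustion U := default
  refine ⟨fun j => ⟨Subtype.val '' C j, (C.isCompact j).image continuous_subtype_val, ?_⟩,
    fun i j hij => Set.image_mono (C.subset hij), fun K => ?_⟩
  · rintro _ ⟨y, -, rfl⟩
    exact y.2
  · obtain ⟨j, hj⟩ := C.exists_superset_of_isCompact (isCompact_preimage K)
    exact ⟨j, fun x hx => ⟨⟨x, K.2.2 hx⟩, hj hx, rfl⟩⟩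

/-- An element of the inverse limit given by a compatible sequence of chains. -/
lemma Perversity.exists_limChain {k : ℕ} {E : ℕ → CompactIn U} (hE : Monotone fun j => (E j).1)
    (hE' : ∀ K : CompactIn U, ∃ j, K.1 ⊆ (E j).1) {e : ℕ → p.Chains R k}
    (he : ∀ j, e (j + 1) - e j ∈ p.subChains R (E j).1ᶜ k) :
    ∃ ε : p.limChains R U k, ∀ (K : CompactIn U) (j : ℕ), K.1 ⊆ (E j).1 →
      ε.1 K = Submodule.Quotient.mk (e j) := by
  have key : ∀ (K : CompactIn U) (i j : ℕ), i ≤ j → K.1 ⊆ (E i).1 →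
      e j - e i ∈ p.subChains R K.1ᶜ k := by
    intro K i j hij hK
    induction j, hij using Nat.le_induction with
    | base =>
      rw [sub_self]
      exact zero_mem _
    | succ j hij ih =>
      have h1 := p.subChains_mono (Set.compl_subset_compl.2 (hK.trans (hE hij))) k (he j)
      convert add_mem h1 ih using 1
      abel
  have key' : ∀ (K : CompactIn U) (i j : ℕ), K.1 ⊆ (E i).1 → K.1 ⊆ (E j).1 →
      (Submodule.Quotient.mk (e i) : p.RelChains R K.1ᶜ k) = Submodule.Quotient.mk (e j) := by
    intro K i j hi hj
    rcases le_total i j with hij | hij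
    · exact ((Submodule.Quotient.eq _).2 (key K i j hij hi)).symm
    · exact (Submodule.Quotient.eq _).2 (key K j i hij hj)
  choose J hJ using hE'
  refine ⟨⟨fun K => Submodule.Quotient.mk (e (J K)), fun K K' h => ?_⟩, fun K j hj => ?_⟩
  · exact key' K (J K') (J K) (h.trans (hJ K')) (hJ K)
  · exact key' K (J K) j (hJ K) hj

/-- A sequence constructed by recursion from a property that can always be continued. -/
lemma exists_seq_of_step {α : Type*} {P : ℕ → α → Prop} {Q : ℕ → α → α → Prop}
    (h0 : ∃ a, P 0 a) (hs : ∀ j a, P j a → ∃ a', P (j + 1) a' ∧ Q j a a') :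
    ∃ s : ℕ → α, ∀ j, P j (s j) ∧ Q j (s j) (s (j + 1)) := by
  obtain ⟨a, ha⟩ := h0
  choose f hf hf' using hs
  let s : ∀ j, {a // P j a} := fun j =>
    Nat.rec ⟨a, ha⟩ (fun j x => ⟨f j x.1 x.2, hf j x.1 x.2⟩) j
  exact ⟨fun j => (s j).1, fun j => ⟨(s j).2, hf' j (s j).1 (s j).2⟩⟩

/-- The step of the construction of a compatible sequence of chains: an excision for a compact
`K'` can be made compatible with a given one for a smaller compact `K`. -/
lemma Perversity.excision_step [T2Space X] [LocallyCompactSpace X] {K K' : Set X}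
    (hU : IsOpen U) (hK : IsCompact K) (hKU : K ⊆ U) (hK' : IsCompact K') (hKU' : K' ⊆ U)
    (hKK' : K ⊆ K') {k : ℕ} {c c' : p.Chains R k} (hc' : p.BdIn (p.sumChains R U K') k c')
    (hcc' : c' - c ∈ p.subChains R Kᶜ k) {e : p.Chains R (k + 1)}
    (he : c - p.d R k e ∈ p.sumChains R U K k) :
    ∃ e', c' - p.d R k e' ∈ p.sumChains R U K' k ∧ e' - e ∈ p.subChains R Kᶜ (k + 1) := by
  obtain ⟨s, hs⟩ := p.excision hU hK' hKU' c' hc'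
  have hmono : p.sumChains R U K' k ≤ p.sumChains R U K k :=
    sup_le_sup_left (p.subChains_mono (Set.compl_subset_compl.2 hKK') k) _
  -- Here ∂(s - e) = (c - ∂e) - (c' - ∂s) + (c' - c), and each summand lies in the sum for the
  -- smaller `K`.
  have h1 : p.d R k (s - e) ∈ p.sumChains R U K k := by
    have h2 := add_mem (sub_mem he (hmono hs))
      (Submodule.mem_sup_right (S := p.subChains R U k) hcc')
    convert h2 using 1
    rw [map_sub]
    abel
  obtain ⟨f, hf⟩ := p.excision hU hK hKU (k := k + 1) (s - e) h1
  obtain ⟨u, hu, w, hw, huw⟩ := Submodule.mem_sup.1 hf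
  -- Subtracting ∂f leaves the differential unchanged, and subtracting `u` changes it by a chain of
  -- `U`; the difference from `e` is exactly `w`.
  refine ⟨s - p.d R (k + 1) f - u, ?_, ?_⟩
  · have h2 : p.d R k (p.d R (k + 1) f) = 0 := LinearMap.congr_fun (p.d_d R k) f
    have h3 : p.d R k u ∈ p.sumChains R U K' k :=
      Submodule.mem_sup_left (p.d_mem_subChains U k hu)
    convert add_mem hs h3 using 1
    rw [map_sub, map_sub, h2]
    abel
  · convert hw using 1
    rw [eq_sub_of_add_eq' huw]
    abel

variable (R p U) in
/-- The condition that the differential of an element of the inverse limit comes from a locally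
finite chain of `U`; in degree zero it is empty. -/
def Perversity.LimBdIn : ∀ k, p.limChains R U k → Prop
  | 0, _ => True
  | k + 1, γ => ∃ η, p.naturalMap R U k η = p.limD R U k γ

/-- The quotient of the inverse limit by the locally finite chains of `U` is acyclic. -/
lemma Perversity.exists_eq_naturalMap_add_limD [T2Space X] [LocallyCompactSpace X]
    [LocallyCompactSpace U] [SigmaCompactSpace U] (hU : IsOpen U) {k : ℕ}
    (γ : p.limChains R U k) (hγ : p.LimBdIn R U k γ) :
    ∃ β ε, γ = p.naturalMap R U k β + p.limD R U k ε := by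
  obtain ⟨E, hE, hE'⟩ := exists_exhaustion (U := U)
  choose c hc using fun j => Submodule.Quotient.mk_surjective _ (γ.1 (E j))
  -- Near `E j` the differential of `c j` agrees with a finite part of η, which is a chain of `U`.
  have hbd : ∀ j, p.BdIn (p.sumChains R U (E j).1) k (c j) := by
    intro j
    cases k with
    | zero => trivial
    | succ k =>
      obtain ⟨η, hη⟩ := hγ
      have h1 : p.restrictAt η (E j) = p.relD R (E j).1ᶜ k (γ.1 (E j)) :=
        congrFun (congrArg Subtype.val hη) (E j)
      rw [← hc] at h1
      have h2 := (Submodule.Quotient.eq _).1 h1.symm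
      have h3 := add_mem (Submodule.mem_sup_right (S := p.subChains R U k) h2)
        (Submodule.mem_sup_left (T := p.subChains R (E j).1ᶜ k)
          (p.pushInter_mem ⟨p.finitePart η (E j), p.finitePart_mem η (E j)⟩))
      rw [sub_add_cancel] at h3
      exact h3
  have hstep : ∀ j, c (j + 1) - c j ∈ p.subChains R (E j).1ᶜ k := by
    intro j
    have h1 := γ.2 (E j) (E (j + 1)) (hE (Nat.le_succ j))
    rw [← hc, ← hc] at h1
    exact (Submodule.Quotient.eq _).1 h1
  obtain ⟨e, he⟩ := exists_seq_of_step
    (P := fun j e => c j - p.d R k e ∈ p.sumChains R U (E j).1 k)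
    (Q := fun j e e' => e' - e ∈ p.subChains R (E j).1ᶜ (k + 1))
    (p.excision hU (E 0).2.1 (E 0).2.2 (c 0) (hbd 0))
    (fun j e he => p.excision_step hU (E j).2.1 (E j).2.2 (E (j + 1)).2.1 (E (j + 1)).2.2
      (hE (Nat.le_succ j)) (hbd (j + 1)) (hstep j) he)
  obtain ⟨ε, hε⟩ := p.exists_limChain hE hE' fun j => (he j).2
  -- For `K ⊆ E j`, the component of γ - ∂ε at `K` is the class of `c j` - ∂(`e j`) = u + w, where u
  -- is a chain of `U` and w, lying outside `E j`, vanishes modulo X \ K.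
  obtain ⟨β, hβ⟩ := p.mem_range_naturalMap (α := γ - p.limD R U k ε) fun K => by
    obtain ⟨j, hj⟩ := hE' K
    obtain ⟨u, hu, w, hw, huw⟩ := Submodule.mem_sup.1 (he j).1
    obtain ⟨u, rfl⟩ := p.mem_range_pushInter hu
    refine ⟨u, ?_⟩
    change γ.1 K - p.relD R K.1ᶜ k (ε.1 K) = _
    rw [hε K j hj, ← γ.2 K (E j) hj, ← hc]
    change (Submodule.Quotient.mk (c j - p.d R k (e j)) : p.RelChains R K.1ᶜ k) = _
    rw [Submodule.Quotient.eq, ← huw, add_sub_cancel_left]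
    exact p.subChains_mono (Set.compl_subset_compl.2 hj) k hw
  refine ⟨β, ε, ?_⟩
  rw [hβ, sub_add_cancel]

end InverseLimit

/-! ### Injective chain maps with acyclic cokernel -/

section QuasiIso

open CategoryTheory

variable {R : Type v} [CommRing R]

/-- The canonical map from a free module onto a module. -/
def freeCover (A : ModuleCat.{max u v} R) : ModuleCat.of R (A →₀ R) ⟶ A :=
  ModuleCat.ofHom (Finsupp.linearCombination R id)

instance (A : ModuleCat.{max u v} R) : Epi (freeCover A) :=
  (ModuleCat.epi_iff_surjective _).2 (Finsupp.linearCombination_id_surjective R A)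

/-- The map from the free module on `A` that is given by a map on `A`. -/
def freeLift {A M : ModuleCat.{max u v} R} (f : A → M) : ModuleCat.of R (A →₀ R) ⟶ M :=
  ModuleCat.ofHom (Finsupp.linearCombination R f)

lemma freeLift_single {A M : ModuleCat.{max u v} R} (f : A → M) (a : A) :
    (freeLift f).hom (Finsupp.single a 1) = f a := by
  simp [freeLift]

lemma freeCover_single {A : ModuleCat.{max u v} R} (a : A) :
    (freeCover A).hom (Finsupp.single a 1) = a := by
  simp [freeCover]

lemma hom_ext_single {A M : ModuleCat.{max u v} R} {f g : ModuleCat.of R (A →₀ R) ⟶ M}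
    (h : ∀ a, f.hom (Finsupp.single a 1) = g.hom (Finsupp.single a 1)) : f = g :=
  ModuleCat.hom_ext (Finsupp.lhom_ext' fun a => LinearMap.ext_ring (h a))

/-- An injective map of chain complexes with acyclic cokernel is a quasi-isomorphism; elementwise
version. -/
lemma quasiIso_of_injective_of_acyclic {K L : ChainComplex (ModuleCat.{max u v} R) ℕ} (f : K ⟶ L)
    (hinj : ∀ k, Function.Injective (f.f k).hom)
    (h0 : ∀ y : L.X 0, ∃ x z, y = (f.f 0).hom x + (L.d 1 0).hom z)
    (hs : ∀ k (y : L.X (k + 1)), (∃ x, (f.f k).hom x = (L.d (k + 1) k).hom y) →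
      ∃ x z, y = (f.f (k + 1)).hom x + (L.d (k + 2) (k + 1)).hom z) : QuasiIso f := by
  have hcomm : ∀ i j (x : K.X i), (f.f j).hom ((K.d i j).hom x) = (L.d i j).hom ((f.f i).hom x) :=
    fun i j x => (LinearMap.congr_fun (congrArg ModuleCat.Hom.hom (f.comm i j)) x).symm
  have hdd : ∀ i j l (x : L.X i), (L.d j l).hom ((L.d i j).hom x) = 0 := fun i j l x =>
    LinearMap.congr_fun (congrArg ModuleCat.Hom.hom (L.d_comp_d i j l)) x
  rw [quasiIso_iff]
  intro k
  rw [quasiIsoAt_iff_isIso_homologyMap]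
  have hprev : (ComplexShape.down ℕ).prev k = k + 1 := ChainComplex.prev ℕ k
  obtain ⟨l, hl⟩ : ∃ l, (ComplexShape.down ℕ).next k = l := ⟨_, rfl⟩
  have hmono : Mono (HomologicalComplex.homologyMap f k) := by
    rw [HomologicalComplex.mono_homologyMap_iff_up_to_refinements f (k + 1) k l hprev hl]
    intro A x₂ hx₂ y₁ hy₁
    have hy : ∀ a, (f.f k).hom (x₂.hom a) = (L.d (k + 1) k).hom (y₁.hom a) := fun a =>
      LinearMap.congr_fun (congrArg ModuleCat.Hom.hom hy₁) a
    -- These elementwise choices need not be linear in `a`. They become morphisms on the free module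
    -- on `A`, whose surjection onto `A` serves as the refinement.
    choose x z hxz using fun a => hs k (y₁.hom a) ⟨_, hy a⟩
    refine ⟨_, freeCover A, inferInstance, freeLift x, hom_ext_single fun a =>
      (congrArg x₂.hom (freeCover_single a)).trans
        (Eq.trans (hinj k ?_) (congrArg (K.d (k + 1) k).hom (freeLift_single x a)).symm)⟩
    -- Since y₁ = f(x) + ∂z, the elements x₂ and ∂x have the same image under `f`, so x₂ = ∂x by
    -- injectivity.
    rw [hy, hcomm, hxz a, map_add, hdd, add_zero]
  have hepi : Epi (HomologicalComplex.homologyMap f k) := by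
    rw [HomologicalComplex.epi_homologyMap_iff_up_to_refinements f (k + 1) k l hprev hl]
    intro A y₂ hy₂
    have hy : ∀ a, (L.d k l).hom (y₂.hom a) = 0 := fun a =>
      LinearMap.congr_fun (congrArg ModuleCat.Hom.hom hy₂) a
    have hex : ∀ a, ∃ x z, y₂.hom a = (f.f k).hom x + (L.d (k + 1) k).hom z := by
      intro a
      cases k with
      | zero => exact h0 _
      | succ k =>
        obtain rfl : k = l := by simpa using hl
        exact hs k _ ⟨0, by rw [map_zero, hy]⟩
    choose x z hxz using hex
    refine ⟨_, freeCover A, inferInstance, freeLift x, hom_ext_single fun a =>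
      (congrArg (K.d k l).hom (freeLift_single x a)).trans (hinj l ?_),
      freeLift z, hom_ext_single fun a => ?_⟩
    -- The cycle y₂ equals f(x) + ∂z, so f(∂x) = 0; injectivity of `f` makes x a cycle.
    · have h1 := hy a
      rw [hxz a, map_add, hdd, add_zero] at h1
      rw [hcomm, h1]
      exact (map_zero _).symm
    · exact (congrArg y₂.hom (freeCover_single a)).trans ((hxz a).trans (congrArg₂ (· + ·)
        (congrArg (f.f k).hom (freeLift_single x a)).symm
        (congrArg (L.d (k + 1) k).hom (freeLift_single z a)).symm))
  exact isIso_of_mono_of_epi _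

end QuasiIso

end

end BMIntersection

/-! ### The natural restriction is a quasi-isomorphism -/

theorem proposition2p2 {X : Type*} [TopologicalSpace X] [T2Space X] [LocallyCompactSpace X]
    [SecondCountableTopology X] {n : ℕ} (F : BMIntersection.Filtration n X)
    (p : BMIntersection.Perversity F) (R : Type*) [CommRing R] (U : Set X) (hU : IsOpen U) :
    QuasiIso (p.naturalRestriction R U) := by
  have : LocallyCompactSpace U := hU.locallyCompactSpace
  have hd : ∀ (k : ℕ) (y : p.limChains R U (k + 1)),
      ((p.limComplex R U).d (k + 1) k).hom y = p.limD R U k y := fun k y => by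
    have h : (p.limComplex R U).d (k + 1) k = ModuleCat.ofHom (p.limD R U k) := by
      simp only [BMIntersection.Perversity.limComplex, ChainComplex.of_d]
    rw [h]
    rfl
  refine BMIntersection.quasiIso_of_injective_of_acyclic _
    (fun k => p.naturalMap_injective k) (fun y => ?_) fun k y hy => ?_
  · obtain ⟨β, ε, h⟩ := p.exists_eq_naturalMap_add_limD hU (k := 0) y trivial
    exact ⟨β, ε, h.trans (congrArg _ (hd 0 ε).symm)⟩
  · obtain ⟨η, hη⟩ := hy
    obtain ⟨β, ε, h⟩ := p.exists_eq_naturalMap_add_limD hU (k := k + 1) y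
      ⟨η, hη.trans (hd k y)⟩
    exact ⟨β, ε, h.trans (congrArg _ (hd (k + 1) ε).symm)⟩
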